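/- Let $T,A,A^m,k,k^m,\sigma,\kappa,\phi,\gamma,\bar\lambda^+,\bar\lambda^->0$ be real numbers and $\tilde q,\tilde q^m,\tilde b\ge 1$ integers. Put $\mathcal Q=\{-\tilde q,\dots,\tilde q\}$, $\mathcal Q^m=\{-\tilde q^m,\dots,\tilde q^m\}$, $\mathcal B=\{-\tilde b,\dots,\tilde b\}$, $$\Lambda(x,y)=A e^{-\frac k\sigma(x+y)},\qquad \Lambda^m(x)=A^m e^{-\frac{k^m}\sigma x},\qquad \bar d(x)=\frac\sigma k+x,\qquad \bar d^m(x)=\frac\sigma{k^m}+x,$$ $$\mathcal L(y,x^b,x^a)=\mathbf 1_{\{y<\tilde q^m\}}\Lambda^m(x^b)-\mathbf 1_{\{y>-\tilde q^m\}}\Lambda^m(x^a).$$ Let $P_0$ be a probability mass function on $\mathcal Q^m\times\mathcal B$. For $W:[0,T]\times\mathcal Q\to\mathbb R$, $W^m,p:[0,T]\times\mathcal Q^m\times\mathcal B\to\mathbb R$, write (omitting $t$) $$\delta^{b}(q)=\bar d\big(W(q)-W(q+1)\big),\qquad \delta^{a}(q)=\bar d\big(W(q)-W(q-1)\big),$$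 $$\delta^{m,b}(y,z)=\bar d^m\big(W^m(y,z)-W^m(y+1,z)\big),\qquad \delta^{m,a}(y,z)=\bar d^m\big(W^m(y,z)-W^m(y-1,z)\big),$$ $$D^i=\sum_{(y,z)\in\mathcal Q^m\times\mathcal B}\delta^{m,i}(y,z)\,p(y,z)\ \ (i\in\{a,b\}),\qquad I=\kappa\sum_{(y,z)\in\mathcal Q^m\times\mathcal B}\mathcal L\big(y,\delta^{m,b}(y,z),\delta^{m,a}(y,z)\big)\,p(y,z).$$ Terms multiplied by a vanishing indicator are $0$, so values off the grids do not matter, except that $D^b$ and $D^a$ contain the quotes $\delta^{m,b}(\tilde q^m,z)$ and $\delta^{m,a}(-\tilde q^m,z)$ on the sides where the risk limit forbids trading. For these, fix any functions $e^\pm:[0,T]\times\mathcal B\times\mathbb R\to\mathbb R$, continuous in the first and third variables jointly, and set $W^m(t,\pm(\tilde q^m+1),z)=e^\pm\big(t,z,W^m(t,\pm\tilde q^m,z)\big)$. The master equation is the following system, for all $t\in[0,T]$ (one-sided derivatives at $0$ and $T$), $q\in\mathcal Q$, $q^m\in\mathcal Q^m$, $b^m\in\mathcal B$. Market-maker's Hamilton–Jacobi–Bellman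 equation: $$0=\partial_tW(q)-\phi\sigma^2q^2+q\,I+\mathbf 1_{\{q<\tilde q\}}\Lambda\big(D^a,\delta^b(q)\big)\big(\delta^b(q)+W(q+1)-W(q)\big)+\mathbf 1_{\{q>-\tilde q\}}\Lambda\big(D^b,\delta^a(q)\big)\big(\delta^a(q)+W(q-1)-W(q)\big).$$ Representative market-taker's Hamilton–Jacobi–Bellman equation: $$\begin{aligned}0=\ &\partial_tW^m(q^m,b^m)-\gamma\sigma^2(q^m)^2+b^mq^m+q^m I\\&+\mathbf 1_{\{b^m<\tilde b\}}\bar\lambda^+\big(W^m(q^m,b^m+1)-W^m(q^m,b^m)\big)+\mathbf 1_{\{b^m>-\tilde b\}}\bar\lambda^-\big(W^m(q^m,b^m-1)-W^m(q^m,b^m)\big)\\&+\mathbf 1_{\{q^m<\tilde q^m\}}\Lambda^m\big(\delta^{m,b}(q^m,b^m)\big)\big(\delta^{m,b}(q^m,b^m)+W^m(q^m+1,b^m)-W^m(q^m,b^m)\big)\\&+\mathbf 1_{\{q^m>-\tilde q^m\}}\Lambda^m\big(\delta^{m,a}(q^m,b^m)\big)\big(\delta^{m,a}(q^m,b^m)+W^m(q^m-1,b^m)-W^m(q^m,b^m)\big).\end{aligned}$$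 Fokker–Planck equation: $$\begin{aligned}0=\ &\partial_tp(q^m,b^m)-\mathbf 1_{\{q^m>-\tilde q^m\}}\Lambda^m\big(\delta^{m,b}(q^m-1,b^m)\big)p(q^m-1,b^m)-\mathbf 1_{\{q^m<\tilde q^m\}}\Lambda^m\big(\delta^{m,a}(q^m+1,b^m)\big)p(q^m+1,b^m)\\&-\bar\lambda^+\mathbf 1_{\{b^m>-\tilde b\}}p(q^m,b^m-1)-\bar\lambda^-\mathbf 1_{\{b^m<\tilde b\}}p(q^m,b^m+1)\\&+\Big(\mathbf 1_{\{q^m<\tilde q^m\}}\Lambda^m\big(\delta^{m,b}(q^m,b^m)\big)+\mathbf 1_{\{q^m>-\tilde q^m\}}\Lambda^m\big(\delta^{m,a}(q^m,b^m)\big)+\bar\lambda^-\mathbf 1_{\{b^m>-\tilde b\}}+\bar\lambda^+\mathbf 1_{\{b^m<\tilde b\}}\Big)p(q^m,b^m).\end{aligned}$$ The conditions are $p(0,\cdot,\cdot)=P_0$, $W(T,\cdot)=0$, $W^m(T,\cdot,\cdot)=0$. **Theorem.** The master equation with these conditions has a solution $(W,W^m,p)$ such that $W$ is $C^1$ in time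 and bounded on $[0,T]\times\mathcal Q$, $W^m$ and $p$ are $C^1$ in time and bounded on $[0,T]\times\mathcal Q^m\times\mathcal B$, and $p(t,\cdot,\cdot)$ is a probability mass function for every $t\in[0,T]$. For every $\delta_\infty>0$ the same holds when quotes are restricted to $[-\delta_\infty,\delta_\infty]$, that is, when $\bar d$ and $\bar d^m$ are replaced throughout by $x\mapsto\max(-\delta_\infty,\min(\delta_\infty,\bar d(x)))$ and $x\mapsto\max(-\delta_\infty,\min(\delta_\infty,\bar d^m(x)))$. -/

import Mathlib

open Set

noncomputable section

/-- The data of the market model: horizon, intensity parameters of the market-maker and of the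
market-takers, volatility, permanent impact, risk aversions, intensities of the signal, and risk
limits (the grids are `{-qMax, …, qMax}`, `{-qmMax, …, qmMax}` and `{-bMax, …, bMax}`).
All of them are positive. -/
structure MarketModel where
  T : ℝ
  A : ℝ
  Am : ℝ
  k : ℝ
  km : ℝ
  σ : ℝ
  κ : ℝ
  φ : ℝ
  γ : ℝ
  lamPlus : ℝ
  lamMinus : ℝ
  qMax : ℤ
  qmMax : ℤ
  bMax : ℤ
  T_pos : 0 < T
  A_pos : 0 < A
  Am_pos : 0 < Am
  k_pos : 0 < k
  km_pos : 0 < km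
  σ_pos : 0 < σ
  κ_pos : 0 < κ
  φ_pos : 0 < φ
  γ_pos : 0 < γ
  lamPlus_pos : 0 < lamPlus
  lamMinus_pos : 0 < lamMinus
  qMax_pos : 0 < qMax
  qmMax_pos : 0 < qmMax
  bMax_pos : 0 < bMax

namespace MarketModel

/-- Inventories of the market-maker. -/
def gridQ (M : MarketModel) : Finset ℤ := Finset.Icc (-M.qMax) M.qMax

/-- Inventories of the market-takers. -/
def gridQm (M : MarketModel) : Finset ℤ := Finset.Icc (-M.qmMax) M.qmMax

/-- Signals of the market-takers. -/
def gridB (M : MarketModel) : Finset ℤ := Finset.Icc (-M.bMax) M.bMax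

/-- Intensity function of the market-maker, `A exp (-(k/σ) (x + y))`. -/
def Lam (M : MarketModel) (x y : ℝ) : ℝ := M.A * Real.exp (-(M.k / M.σ) * (x + y))

/-- Intensity function of the market-takers, `Aᵐ exp (-(kᵐ/σ) x)`. -/
def Lamm (M : MarketModel) (x : ℝ) : ℝ := M.Am * Real.exp (-(M.km / M.σ) * x)

/-- `π (y, z)`, for `y` an inventory and `z` a signal, is a probability mass function on the
grid of the market-takers (its values off the grid are irrelevant). -/
def IsPMF (M : MarketModel) (π : ℤ → ℤ → ℝ) : Prop :=
  (∀ y ∈ M.gridQm, ∀ z ∈ M.gridB, 0 ≤ π y z) ∧ ∑ y ∈ M.gridQm, ∑ z ∈ M.gridB, π y z = 1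

/-- Integral of `f (y, z)` against the mass function `π`. -/
def integ (M : MarketModel) (f π : ℤ → ℤ → ℝ) : ℝ :=
  ∑ y ∈ M.gridQm, ∑ z ∈ M.gridB, f y z * π y z

/-- Net rate of the trades of a market-taker with inventory `y` and quotes `xb`, `xa`
(bid trades raise the inventory, ask trades lower it). -/
def netRate (M : MarketModel) (y : ℤ) (xb xa : ℝ) : ℝ :=
  (if y < M.qmMax then 1 else 0) * M.Lamm xb - (if -M.qmMax < y then 1 else 0) * M.Lamm xa

/-- The permanent-impact drift `κ ∫ netRate (y, δᵇ(y,z), δᵃ(y,z)) π(dy,dz)`. -/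
def impact (M : MarketModel) (δb δa π : ℤ → ℤ → ℝ) : ℝ :=
  M.κ * M.integ (fun y z => M.netRate y (δb y z) (δa y z)) π

/-- `H (d, z, z') = d + z' - z`. -/
def gain (d z z' : ℝ) : ℝ := d + z' - z

/-- Hamiltonian of the market-maker; `δb`, `δa` are the quotes of the market-takers as functions
of inventory and signal, and `π` is their law. -/
def hamMaker (M : MarketModel) (q : ℤ) (d₁ d₂ z z₁ z₂ : ℝ) (δb δa π : ℤ → ℤ → ℝ) : ℝ :=
  (if q < M.qMax then 1 else 0) * M.Lam (M.integ δa π) d₁ * gain d₁ z z₁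
    + (if -M.qMax < q then 1 else 0) * M.Lam (M.integ δb π) d₂ * gain d₂ z z₂

/-- Hamiltonian of the representative market-taker. -/
def hamTaker (M : MarketModel) (qm : ℤ) (d₁ d₂ z z₁ z₂ : ℝ) : ℝ :=
  (if qm < M.qmMax then 1 else 0) * M.Lamm d₁ * gain d₁ z z₁
    + (if -M.qmMax < qm then 1 else 0) * M.Lamm d₂ * gain d₂ z z₂

/-- Generator of the signal. -/
def genSignal (M : MarketModel) (b : ℤ) (z z₁ z₂ : ℝ) : ℝ :=
  (if b < M.bMax then 1 else 0) * M.lamPlus * (z₁ - z)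
    + (if -M.bMax < b then 1 else 0) * M.lamMinus * (z₂ - z)

/-- The terms other than `∂ₜ p` in the Fokker–Planck equation, for the quotes `δb`, `δa`. -/
def fokkerPlanck (M : MarketModel) (δb δa π : ℤ → ℤ → ℝ) (q b : ℤ) : ℝ :=
  - (if -M.qmMax < q then 1 else 0) * M.Lamm (δb (q - 1) b) * π (q - 1) b
    - (if q < M.qmMax then 1 else 0) * M.Lamm (δa (q + 1) b) * π (q + 1) b
    - M.lamPlus * (if -M.bMax < b then 1 else 0) * π q (b - 1)
    - M.lamMinus * (if b < M.bMax then 1 else 0) * π q (b + 1)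
    + ((if q < M.qmMax then 1 else 0) * M.Lamm (δb q b)
        + (if -M.qmMax < q then 1 else 0) * M.Lamm (δa q b)
        + M.lamMinus * (if -M.bMax < b then 1 else 0)
        + M.lamPlus * (if b < M.bMax then 1 else 0)) * π q b

/-- The maximiser of the Hamiltonian of the market-maker, `x ↦ σ/k + x`. -/
def dbar (M : MarketModel) (x : ℝ) : ℝ := M.σ / M.k + x

/-- The maximiser of the Hamiltonian of the market-taker, `x ↦ σ/kᵐ + x`. -/
def dmbar (M : MarketModel) (x : ℝ) : ℝ := M.σ / M.km + x

/-- Projection of a quote on `[-δ∞, δ∞]`. -/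
def clamp (δinf x : ℝ) : ℝ := max (-δinf) (min δinf x)

/-- Bid quote of a market-taker with inventory `q`, signal `b` and value function `w`. -/
def takerBid (fm : ℝ → ℝ) (w : ℤ → ℤ → ℝ) (q b : ℤ) : ℝ := fm (w q b - w (q + 1) b)

/-- Ask quote of a market-taker with inventory `q`, signal `b` and value function `w`. -/
def takerAsk (fm : ℝ → ℝ) (w : ℤ → ℤ → ℝ) (q b : ℤ) : ℝ := fm (w q b - w (q - 1) b)

/-- `(W, Wm, p)` solves the master equation on `[0, T]`, where `f` and `fm` are the feedback maps
of the market-maker and of the market-takers. Functions are indexed by all integers, and every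
condition is on the grid; `∂ₜ` is the derivative on `[0, T]`, one-sided at the end points.

The only values of `W`, `Wm`, `p` off the grid which matter are those of `Wm` at the inventories
`±(qmMax + 1)`: they fix the quotes of a market-taker on the side on which the risk limit forbids
him to trade, which enter nothing but the mean quotes seen by the market-maker. They are
prescribed, as functions `ePlus`, `eMinus` of time, signal and the value of `Wm` at the
neighbouring point of the grid. -/
structure IsMasterSolution (M : MarketModel) (f fm : ℝ → ℝ) (ePlus eMinus : ℝ → ℤ → ℝ → ℝ)
    (P₀ : ℤ → ℤ → ℝ) (W : ℝ → ℤ → ℝ) (Wm p : ℝ → ℤ → ℤ → ℝ) : Prop where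
  contDiff_W : ∀ q ∈ M.gridQ, ContDiffOn ℝ 1 (fun t => W t q) (Icc 0 M.T)
  contDiff_Wm : ∀ q ∈ M.gridQm, ∀ b ∈ M.gridB, ContDiffOn ℝ 1 (fun t => Wm t q b) (Icc 0 M.T)
  contDiff_p : ∀ q ∈ M.gridQm, ∀ b ∈ M.gridB, ContDiffOn ℝ 1 (fun t => p t q b) (Icc 0 M.T)
  bounded_W : ∃ C, ∀ t ∈ Icc 0 M.T, ∀ q ∈ M.gridQ, |W t q| ≤ C
  bounded_Wm : ∃ C, ∀ t ∈ Icc 0 M.T, ∀ q ∈ M.gridQm, ∀ b ∈ M.gridB, |Wm t q b| ≤ C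
  bounded_p : ∃ C, ∀ t ∈ Icc 0 M.T, ∀ q ∈ M.gridQm, ∀ b ∈ M.gridB, |p t q b| ≤ C
  /-- `p t` is the mass function of a probability on the grid. -/
  pmf : ∀ t ∈ Icc 0 M.T, M.IsPMF (p t)
  ghost_plus : ∀ t ∈ Icc 0 M.T, ∀ b ∈ M.gridB,
    Wm t (M.qmMax + 1) b = ePlus t b (Wm t M.qmMax b)
  ghost_minus : ∀ t ∈ Icc 0 M.T, ∀ b ∈ M.gridB,
    Wm t (-M.qmMax - 1) b = eMinus t b (Wm t (-M.qmMax) b)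
  /-- Hamilton–Jacobi–Bellman equation of the market-maker. -/
  hjb_maker : ∀ t ∈ Icc 0 M.T, ∀ q ∈ M.gridQ,
    0 = derivWithin (fun s => W s q) (Icc 0 M.T) t - M.φ * M.σ ^ 2 * (q : ℝ) ^ 2
      + q * M.impact (takerBid fm (Wm t)) (takerAsk fm (Wm t)) (p t)
      + M.hamMaker q (f (W t q - W t (q + 1))) (f (W t q - W t (q - 1)))
          (W t q) (W t (q + 1)) (W t (q - 1))
          (takerBid fm (Wm t)) (takerAsk fm (Wm t)) (p t)
  /-- Hamilton–Jacobi–Bellman equation of the representative market-taker. -/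
  hjb_taker : ∀ t ∈ Icc 0 M.T, ∀ q ∈ M.gridQm, ∀ b ∈ M.gridB,
    0 = derivWithin (fun s => Wm s q b) (Icc 0 M.T) t - M.γ * M.σ ^ 2 * (q : ℝ) ^ 2
      + (b : ℝ) * q + M.genSignal b (Wm t q b) (Wm t q (b + 1)) (Wm t q (b - 1))
      + q * M.impact (takerBid fm (Wm t)) (takerAsk fm (Wm t)) (p t)
      + M.hamTaker q (fm (Wm t q b - Wm t (q + 1) b)) (fm (Wm t q b - Wm t (q - 1) b))
          (Wm t q b) (Wm t (q + 1) b) (Wm t (q - 1) b)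
  /-- Fokker–Planck equation. -/
  fokker_planck : ∀ t ∈ Icc 0 M.T, ∀ q ∈ M.gridQm, ∀ b ∈ M.gridB,
    0 = derivWithin (fun s => p s q b) (Icc 0 M.T) t
      + M.fokkerPlanck (takerBid fm (Wm t)) (takerAsk fm (Wm t)) (p t) q b
  initial_p : ∀ q ∈ M.gridQm, ∀ b ∈ M.gridB, p 0 q b = P₀ q b
  terminal_W : ∀ q ∈ M.gridQ, W M.T q = 0
  terminal_Wm : ∀ q ∈ M.gridQm, ∀ b ∈ M.gridB, Wm M.T q b = 0

end MarketModel

end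

/-!
The value function of the market-takers is prescribed at time `T` and their law at time `0`, so
their equations form a two-point problem for a finite system of ordinary differential equations with
continuous right-hand side. When the unknowns are truncated to a box the right-hand side becomes
bounded, and Schauder's theorem yields a solution; it remains to bound this solution independently
of the truncation. The impact drift is `κ` times the derivative of the mean inventory, hence
`Wᵐ(t, q, b) - κ q (m(T) - m(t))`, where `m` is the mean inventory, solves an equation from which
the impact has disappeared. At a maximum of this shifted function on the grid the differences of
`Wᵐ` are controlled, and one-sided bounds on the Hamiltonian suffice for a maximum principle. With
`Wᵐ` and `p` known, the equation of the market-maker is solved by the same argument.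
-/

noncomputable section

/-! ### Brouwer's fixed point theorem -/

section Brouwer

open MeasureTheory Polynomial Metric Module Filter Topology

lemma exists_polynomial_eval_eq_integral {α : Type*} [MeasurableSpace α] {μ : Measure α}
    {f : ℝ → α → ℝ} {N : ℕ} (hint : ∀ t, Integrable (f t) μ)
    (hpoly : ∀ x, ∃ p : ℝ[X], p.natDegree ≤ N ∧ ∀ t, p.eval t = f t x) :
    ∃ P : ℝ[X], ∀ t, P.eval t = ∫ x, f t x ∂μ := by
  let s := Finset.range (N + 1)
  let v : ℕ → ℝ := Nat.cast
  have hv : InjOn v s := Nat.cast_injective.injOn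
  have hinterp (t : ℝ) (x : α) : f t x = ∑ i ∈ s, f i x * (Lagrange.basis s v i).eval t := by
    obtain ⟨p, hdeg, hp⟩ := hpoly x
    have hlt : p.degree < s.card := by
      rw [Finset.card_range]
      exact degree_le_natDegree.trans_lt (mod_cast Nat.lt_succ_of_le hdeg)
    conv_lhs => rw [← hp, Lagrange.eq_interpolate hv hlt, Lagrange.interpolate_apply]
    simp only [eval_finsetSum, eval_mul, eval_C, hp, v]
  refine ⟨∑ i ∈ s, C (∫ x, f i x ∂μ) * Lagrange.basis s v i, fun t ↦ ?_⟩
  simp_rw [hinterp t, eval_finsetSum, eval_mul, eval_C, ← integral_mul_const]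
  exact (integral_finsetSum s fun i _ ↦ (hint i).mul_const _).symm

lemma exists_polynomial_eval_eq_det_one_add_smul {R M : Type*} [CommRing R] [Nontrivial R]
    [AddCommGroup M] [Module R M] [Module.Free R M] [Module.Finite R M] (A : End R M) :
    ∃ p : R[X], p.natDegree ≤ finrank R M ∧ ∀ t, p.eval t = LinearMap.det (1 + t • A) := by
  classical
  let b := finBasis R M
  let B := LinearMap.toMatrix b b A
  refine ⟨Matrix.det ((X : R[X]) • B.map C + (1 : Matrix _ _ R).map C), ?_, fun t ↦ ?_⟩
  · simpa using natDegree_det_X_add_C_le B 1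
  · rw [eval_det, ← LinearMap.det_toMatrix b]
    congr 1
    ext i j
    rw [matPolyEquiv_eval]
    simp only [Matrix.add_apply, Matrix.smul_apply, Matrix.map_apply,
      smul_eq_mul, eval_add, eval_mul, eval_X, eval_C, map_add, map_smul, B,
      LinearMap.toMatrix_one]
    ring

lemma injOn_id_add_of_lipschitzOnWith {E : Type*} [NormedAddCommGroup E] {g : E → E}
    {K : NNReal} {s : Set E} (hg : LipschitzOnWith K g s) (hK : K < 1) :
    InjOn (fun x ↦ x + g x) s := by
  intro x hx y hy hxy
  have hdist : dist x y ≤ K * dist x y := calc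
    dist x y = dist (g x) (g y) := by
      have hsub : y - x = g x - g y := by
        rw [sub_eq_sub_iff_add_eq_add, add_comm (g x)]
        exact hxy.symm
      rw [dist_eq_norm', dist_eq_norm, hsub]
    _ ≤ K * dist x y := hg.dist_le_mul x hx y hy
  exact dist_le_zero.1 (by nlinarith [NNReal.coe_lt_one.2 hK, dist_nonneg (x := x) (y := y)])

section NormedSpace

variable {E : Type*} [NormedAddCommGroup E] [NormedSpace ℝ E]

lemma det_id_add_pos_of_norm_lt_one [FiniteDimensional ℝ E] {A : E →L[ℝ] E} (hA : ‖A‖ < 1) :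
    0 < (ContinuousLinearMap.id ℝ E + A).det := by
  have hne (s : ℝ) (hs : s ∈ Icc (0 : ℝ) 1) : (ContinuousLinearMap.id ℝ E + s • A).det ≠ 0 := by
    have hnorm : ‖-(s • A)‖ < 1 := by
      rw [norm_neg, norm_smul, Real.norm_of_nonneg hs.1]
      exact (mul_le_of_le_one_left (norm_nonneg A) hs.2).trans_lt hA
    have hunit := isUnit_one_sub_of_norm_lt_one hnorm
    rw [sub_neg_eq_add] at hunit
    exact ((hunit.map ContinuousLinearMap.toLinearMapRingHom).map LinearMap.det).ne_zero
  have hcont : ContinuousOn (fun s : ℝ ↦ (ContinuousLinearMap.id ℝ E + s • A).det) (Icc 0 1) :=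
    (ContinuousLinearMap.continuous_det.comp (by fun_prop)).continuousOn
  by_contra! hneg
  obtain ⟨s, hs, hs0⟩ := intermediate_value_Icc' (zero_le_one' ℝ) hcont
    (show (0 : ℝ) ∈ Icc _ _ from ⟨by rwa [one_smul], by simp [ContinuousLinearMap.det]⟩)
  exact hne s hs hs0

lemma isOpen_image_of_det_ne_zero [FiniteDimensional ℝ E] {f : E → E} {f' : E → E →L[ℝ] E}
    {s : Set E} (hs : IsOpen s) (hf : ∀ x ∈ s, HasStrictFDerivAt f (f' x) x)
    (hdet : ∀ x ∈ s, (f' x).det ≠ 0) : IsOpen (f '' s) := by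
  rw [isOpen_iff_mem_nhds]
  rintro _ ⟨x, hx, rfl⟩
  have hequiv : HasStrictFDerivAt f
      ((f' x).toContinuousLinearEquivOfDetNeZero (hdet x hx) : E →L[ℝ] E) x := by
    simpa using hf x hx
  rw [← hequiv.map_nhds_eq_of_equiv]
  exact image_mem_map (hs.mem_nhds hx)

lemma image_ball_eq_ball [ProperSpace E] {f : E → E} {c : E} {r : ℝ} (hr : 0 < r)
    (hf : ContinuousOn f (closedBall c r)) (hmaps : MapsTo f (closedBall c r) (closedBall c r))
    (hsphere : EqOn f id (sphere c r)) (hopen : IsOpen (f '' ball c r)) :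
    f '' ball c r = ball c r := by
  have hsub : f '' ball c r ⊆ ball c r := by
    have hint : f '' ball c r ⊆ interior (closedBall c r) :=
      interior_maximal ((image_mono ball_subset_closedBall).trans hmaps.image_subset) hopen
    rwa [interior_closedBall c hr.ne'] at hint
  have hclosed : IsClosed (f '' closedBall c r) :=
    ((isCompact_closedBall c r).image_of_continuousOn hf).isClosed
  have hcentre : f c ∈ f '' ball c r := mem_image_of_mem f (mem_ball_self hr)
  refine hsub.antisymm <| (convex_ball c r).isPreconnected.subset_of_closure_inter_subset hopen
    ⟨f c, hsub hcentre, hcentre⟩ ?_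
  rintro y ⟨hy, hyball⟩
  obtain ⟨x, hx, rfl⟩ := hclosed.closure_subset_iff.2 (image_mono ball_subset_closedBall) hy
  rcases (mem_closedBall.1 hx).lt_or_eq with hlt | heq
  · exact mem_image_of_mem f hlt
  · rw [hsphere (mem_sphere.2 heq)] at hyball
    exact absurd hyball (by simp [heq])

lemma exists_polynomial_eval_eq_setIntegral_det {X : Type*} [TopologicalSpace X] [T2Space X]
    [MeasurableSpace X] [OpensMeasurableSpace X] (ν : Measure X) [IsFiniteMeasureOnCompacts ν]
    [FiniteDimensional ℝ E] {K s : Set X} {A : X → E →L[ℝ] E} (hK : IsCompact K)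
    (hA : ContinuousOn A K) (hs : s ⊆ K) :
    ∃ P : ℝ[X], ∀ t, P.eval t = ∫ x in s, (ContinuousLinearMap.id ℝ E + t • A x).det ∂ν := by
  refine exists_polynomial_eval_eq_integral (fun t ↦ ?_) fun x ↦
    exists_polynomial_eval_eq_det_one_add_smul (A x : End ℝ E)
  have hdet : ContinuousOn (fun x ↦ (ContinuousLinearMap.id ℝ E + t • A x).det) K :=
    ContinuousLinearMap.continuous_det.comp_continuousOn
      (continuousOn_const.add (hA.const_smul t))
  exact (hdet.integrableOn_compact hK).mono_set hs

variable [FiniteDimensional ℝ E] [MeasurableSpace E] [BorelSpace E] (μ : Measure E)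
  [μ.IsAddHaarMeasure]

lemma setIntegral_det_eq_measureReal_image {f : E → E} {f' : E → E →L[ℝ] E} {s : Set E}
    (hs : MeasurableSet s) (hf : ∀ x ∈ s, HasFDerivWithinAt f (f' x) s x) (hinj : InjOn f s)
    (hdet : ∀ x ∈ s, 0 ≤ (f' x).det) : ∫ x in s, (f' x).det ∂μ = μ.real (f '' s) := by
  have himage := integral_image_eq_integral_abs_det_fderiv_smul μ hs hf hinj fun _ ↦ (1 : ℝ)
  simp only [smul_eq_mul, mul_one, integral_const, measureReal_restrict_apply_univ] at himage
  rw [himage]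
  exact setIntegral_congr_fun hs fun x hx ↦ (abs_of_nonneg (hdet x hx)).symm

lemma setIntegral_det_id_add_eq_measureReal_ball {g : E → E} {g' : E → E →L[ℝ] E} {K : NNReal}
    {c : E} {r : ℝ} (hr : 0 < r) (hg : ∀ x ∈ closedBall c r, HasStrictFDerivAt g (g' x) x)
    (hK : K < 1) (hg' : ∀ x ∈ closedBall c r, ‖g' x‖₊ ≤ K)
    (hmaps : MapsTo (fun x ↦ x + g x) (closedBall c r) (closedBall c r))
    (hsphere : ∀ x ∈ sphere c r, g x = 0) :
    ∫ x in ball c r, (ContinuousLinearMap.id ℝ E + g' x).det ∂μ = μ.real (ball c r) := by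
  have hderiv (x) (hx : x ∈ closedBall c r) :
      HasStrictFDerivAt (fun x ↦ x + g x) (ContinuousLinearMap.id ℝ E + g' x) x :=
    (hasStrictFDerivAt_id x).add (hg x hx)
  have hpos (x) (hx : x ∈ ball c r) : 0 < (ContinuousLinearMap.id ℝ E + g' x).det :=
    det_id_add_pos_of_norm_lt_one (lt_of_le_of_lt (hg' x (ball_subset_closedBall hx)) hK)
  have hlip : LipschitzOnWith K g (closedBall c r) :=
    (convex_closedBall c r).lipschitzOnWith_of_nnnorm_hasFDerivWithin_le
      (fun x hx ↦ (hg x hx).hasFDerivAt.hasFDerivWithinAt) hg'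
  have himage : (fun x ↦ x + g x) '' ball c r = ball c r :=
    image_ball_eq_ball hr
      (fun x hx ↦ (hderiv x hx).hasFDerivAt.continuousAt.continuousWithinAt) hmaps
      (fun x hx ↦ by simp [hsphere x hx])
      (isOpen_image_of_det_ne_zero isOpen_ball
        (fun x hx ↦ hderiv x (ball_subset_closedBall hx)) fun x hx ↦ (hpos x hx).ne')
  rw [setIntegral_det_eq_measureReal_image μ measurableSet_ball
    (fun x hx ↦ (hderiv x (ball_subset_closedBall hx)).hasFDerivAt.hasFDerivWithinAt)
    ((injOn_id_add_of_lipschitzOnWith hlip hK).mono ball_subset_closedBall)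
    (fun x hx ↦ (hpos x hx).le), himage]

lemma exists_setIntegral_det_id_add_smul_eq_measureReal_ball {g : E → E} {g' : E → E →L[ℝ] E}
    {c : E} {r : ℝ} (hr : 0 < r) (hg : ∀ x ∈ closedBall c r, HasStrictFDerivAt g (g' x) x)
    (hg' : ContinuousOn g' (closedBall c r))
    (hmaps : ∀ x ∈ closedBall c r, x + g x ∈ closedBall c r)
    (hsphere : ∀ x ∈ sphere c r, g x = 0) :
    ∃ T > (0 : ℝ), ∀ t ∈ Ioo 0 T,
      ∫ x in ball c r, (ContinuousLinearMap.id ℝ E + t • g' x).det ∂μ = μ.real (ball c r) := by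
  obtain ⟨C, hC⟩ := (isCompact_closedBall c r).exists_bound_of_continuousOn hg'
  refine ⟨(max 1 C)⁻¹, by positivity, fun t ⟨ht0, ht⟩ ↦ ?_⟩
  have ht1 : t ≤ 1 := ht.le.trans (inv_le_one_of_one_le₀ (le_max_left _ _))
  have htC : (t * max 1 C).toNNReal < 1 := by
    rw [Real.toNNReal_lt_one, ← lt_div_iff₀ (by positivity), one_div]
    exact ht
  refine setIntegral_det_id_add_eq_measureReal_ball μ (g := fun x ↦ t • g x) hr
    (fun x hx ↦ (hg x hx).const_smul t) htC (fun x hx ↦ ?_) (fun x hx ↦ ?_)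
    fun x hx ↦ by simp [hsphere x hx]
  · refine NNReal.le_toNNReal_of_coe_le ?_
    rw [coe_nnnorm, norm_smul, Real.norm_of_nonneg ht0.le]
    exact mul_le_mul_of_nonneg_left ((hC x hx).trans (le_max_right _ _)) ht0.le
  · simpa using (convex_closedBall c r).add_smul_sub_mem hx (hmaps x hx) ⟨ht0.le, ht1⟩

end NormedSpace

variable {E : Type*} [NormedAddCommGroup E] [InnerProductSpace ℝ E]

open scoped RealInnerProductSpace

lemma det_eq_zero_of_norm_eventually_const [FiniteDimensional ℝ E] {f : E → E} {f' : E →L[ℝ] E}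
    {x : E} (hf : HasFDerivAt f f' x) (hx : f x ≠ 0) (hnorm : ∀ᶠ y in 𝓝 x, ‖f y‖ = ‖f x‖) :
    f'.det = 0 := by
  have hconst : HasFDerivAt (fun y ↦ ‖f y‖ ^ 2) (0 : E →L[ℝ] ℝ) x :=
    (hasFDerivAt_const (‖f x‖ ^ 2) x).congr_of_eventuallyEq (hnorm.mono fun y hy ↦ by simp [hy])
  have horth (v : E) : ⟪f x, f' v⟫ = 0 := by
    simpa using congrArg (fun L : E →L[ℝ] ℝ ↦ L v) (hf.norm_sq.unique hconst)
  by_contra hdet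
  obtain ⟨v, hv⟩ := (f'.toContinuousLinearEquivOfDetNeZero hdet).surjective (f x)
  have hv' : f' v = f x := by simpa using hv
  exact hx (inner_self_eq_zero.1 (hv' ▸ horth v))

/-- For `t` near `0` the map `x ↦ x + t • (r x - x)` is a diffeomorphism of the ball, so that the
integral of its Jacobian, a polynomial in `t`, is constant; for `t = 1` the Jacobian vanishes. -/
theorem not_contDiffAt_retraction_sphere [FiniteDimensional ℝ E] {r : E → E}
    (hr : ∀ x ∈ closedBall (0 : E) 1, ContDiffAt ℝ 1 r x)
    (hnorm : ∀ x ∈ closedBall (0 : E) 1, ‖r x‖ = 1) : ¬ ∀ x ∈ sphere (0 : E) 1, r x = x := by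
  intro hsphere
  borelize E
  let A : E → E →L[ℝ] E := fun x ↦ fderiv ℝ r x - ContinuousLinearMap.id ℝ E
  have hr' (x) (hx : x ∈ closedBall (0 : E) 1) : HasStrictFDerivAt r (fderiv ℝ r x) x :=
    (hr x hx).hasStrictFDerivAt one_ne_zero
  have hA : ContinuousOn A (closedBall 0 1) := fun x hx ↦
    (((hr x hx).fderiv_right (m := 0) (by simp)).continuousAt.sub
      continuousAt_const).continuousWithinAt
  obtain ⟨P, hP⟩ := exists_polynomial_eval_eq_setIntegral_det volume (isCompact_closedBall _ _) hA
    (ball_subset_closedBall : ball (0 : E) 1 ⊆ closedBall 0 1)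
  obtain ⟨T, hT, hsmall⟩ := exists_setIntegral_det_id_add_smul_eq_measureReal_ball volume one_pos
    (g := fun x ↦ r x - x) (fun x hx ↦ (hr' x hx).sub (hasStrictFDerivAt_id x)) hA
    (fun x hx ↦ by simp [hnorm x hx]) fun x hx ↦ by simp [hsphere x hx]
  have hPconst : P = Polynomial.C (volume.real (ball (0 : E) 1)) :=
    eq_of_infinite_eval_eq _ _ ((Ioo_infinite hT).mono fun t ht ↦
      (hP t).trans ((hsmall t ht).trans eval_C.symm))
  have hone : P.eval 1 = 0 := by
    rw [hP]
    refine setIntegral_eq_zero_of_forall_eq_zero fun x hx ↦ ?_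
    have hx' := ball_subset_closedBall hx
    rw [one_smul, add_sub_cancel]
    refine det_eq_zero_of_norm_eventually_const (hr' x hx').hasFDerivAt
      (norm_pos_iff.1 (by simp [hnorm x hx'])) ?_
    filter_upwards [isOpen_ball.mem_nhds hx] with y hy
    rw [hnorm y (ball_subset_closedBall hy), hnorm x hx']
  have hvol : 0 < volume.real (ball (0 : E) 1) :=
    ENNReal.toReal_pos (measure_ball_pos _ _ one_pos).ne' measure_ball_lt_top.ne
  rw [hPconst, eval_C] at hone
  exact hvol.ne' hone

/-- The larger root `l` of `‖x + l • u‖ = 1`: for `x` in the closed unit ball and `u ≠ 0`, the ray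
from `x` in the direction `u` leaves the ball at `x + sphereHit x u • u`. -/
def sphereHit (x u : E) : ℝ :=
  (-⟪x, u⟫ + √(⟪x, u⟫ ^ 2 + ‖u‖ ^ 2 * (1 - ‖x‖ ^ 2))) / ‖u‖ ^ 2

lemma sphereHit_eq_zero {x u : E} (hx : ‖x‖ = 1) (hxu : 0 ≤ ⟪x, u⟫) : sphereHit x u = 0 := by
  simp [sphereHit, hx, Real.sqrt_sq hxu]

lemma norm_add_sphereHit_smul {x u : E} (hu : u ≠ 0) (hx : ‖x‖ ≤ 1) :
    ‖x + sphereHit x u • u‖ = 1 := by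
  have hu' : ‖u‖ ^ 2 ≠ 0 := pow_ne_zero 2 (norm_ne_zero_iff.2 hu)
  have hdisc : 0 ≤ ⟪x, u⟫ ^ 2 + ‖u‖ ^ 2 * (1 - ‖x‖ ^ 2) :=
    add_nonneg (sq_nonneg _) (mul_nonneg (sq_nonneg _)
      (sub_nonneg.2 (pow_le_one₀ (norm_nonneg x) hx)))
  have hmul : sphereHit x u * ‖u‖ ^ 2 = _ := div_mul_cancel₀ _ hu'
  have hroot : (sphereHit x u * ‖u‖ ^ 2 + ⟪x, u⟫) ^ 2
      = ⟪x, u⟫ ^ 2 + ‖u‖ ^ 2 * (1 - ‖x‖ ^ 2) := by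
    rw [hmul, neg_add_cancel_comm, Real.sq_sqrt hdisc]
  have hexpand : ‖x + sphereHit x u • u‖ ^ 2
      = ‖x‖ ^ 2 + 2 * (sphereHit x u * ⟪x, u⟫) + sphereHit x u ^ 2 * ‖u‖ ^ 2 := by
    rw [norm_add_sq_real, inner_smul_right, norm_smul, mul_pow, Real.norm_eq_abs, sq_abs]
  refine (pow_eq_one_iff_of_nonneg (norm_nonneg _) two_ne_zero).1 ?_
  rw [hexpand]
  refine mul_right_cancel₀ hu' ?_
  linear_combination hroot

lemma contDiffAt_sphereHit {u : E → E} {n : WithTop ℕ∞} {x : E} (hu : ContDiffAt ℝ n u x)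
    (hux : u x ≠ 0) (hx : ‖x‖ ≤ 1) (hxu : ‖x‖ = 1 → 0 < ⟪x, u x⟫) :
    ContDiffAt ℝ n (fun y ↦ sphereHit y (u y)) x := by
  have hu2 : 0 < ‖u x‖ ^ 2 := pow_pos (norm_pos_iff.2 hux) 2
  have hdisc : 0 < ⟪x, u x⟫ ^ 2 + ‖u x‖ ^ 2 * (1 - ‖x‖ ^ 2) := by
    rcases hx.lt_or_eq with hlt | heq
    · have : 0 < 1 - ‖x‖ ^ 2 := sub_pos.2 (pow_lt_one₀ (norm_nonneg x) hlt two_ne_zero)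
      positivity
    · simpa [heq] using pow_pos (hxu heq) 2
  have hinner : ContDiffAt ℝ n (fun y ↦ ⟪y, u y⟫) x := contDiffAt_id.inner ℝ hu
  have hdiscr := (hinner.pow 2).add
    ((hu.norm_sq ℝ).mul ((contDiffAt_const (c := (1 : ℝ))).sub (contDiffAt_id.norm_sq ℝ)))
  exact (hinner.neg.add (hdiscr.sqrt hdisc.ne')).div (hu.norm_sq ℝ) hu2.ne'

lemma inner_sub_pos_of_norm_le {x y : E} (hxy : x ≠ y) (hnorm : ‖y‖ ≤ ‖x‖) : 0 < ⟪x, x - y⟫ := by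
  have hexpand : ‖x - y‖ ^ 2 = ‖x‖ ^ 2 - 2 * ⟪x, y⟫ + ‖y‖ ^ 2 := norm_sub_sq_real x y
  have hpos : 0 < ‖x - y‖ ^ 2 := pow_pos (norm_pos_iff.2 (sub_ne_zero.2 hxy)) 2
  have hsq : ‖y‖ ^ 2 ≤ ‖x‖ ^ 2 := pow_le_pow_left₀ (norm_nonneg y) hnorm 2
  rw [inner_sub_right, real_inner_self_eq_norm_sq]
  linarith

theorem exists_fixedPoint_of_contDiff [FiniteDimensional ℝ E] {f : E → E} (hf : ContDiff ℝ 1 f)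
    (hmaps : MapsTo f (closedBall 0 1) (closedBall 0 1)) :
    ∃ x ∈ closedBall (0 : E) 1, f x = x := by
  by_contra! hne
  have hnorm (x) (hx : x ∈ closedBall (0 : E) 1) : ‖x‖ ≤ 1 ∧ ‖f x‖ ≤ 1 :=
    ⟨mem_closedBall_zero_iff.1 hx, mem_closedBall_zero_iff.1 (hmaps hx)⟩
  have hinner (x) (hx : x ∈ closedBall (0 : E) 1) (hx1 : ‖x‖ = 1) : 0 < ⟪x, x - f x⟫ :=
    inner_sub_pos_of_norm_le (hne x hx).symm (hx1 ▸ (hnorm x hx).2)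
  have hu (x) (hx : x ∈ closedBall (0 : E) 1) : x - f x ≠ 0 := sub_ne_zero.2 (hne x hx).symm
  have hdiff : ContDiff ℝ 1 fun x ↦ x - f x := contDiff_id.sub hf
  refine not_contDiffAt_retraction_sphere (r := fun x ↦ x + sphereHit x (x - f x) • (x - f x))
    (fun x hx ↦ contDiffAt_id.add ((contDiffAt_sphereHit hdiff.contDiffAt (hu x hx)
      (hnorm x hx).1 (hinner x hx)).smul hdiff.contDiffAt))
    (fun x hx ↦ norm_add_sphereHit_smul (hu x hx) (hnorm x hx).1) fun x hx ↦ ?_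
  have hx1 : ‖x‖ = 1 := mem_sphere_zero_iff_norm.1 hx
  rw [sphereHit_eq_zero hx1 (hinner x (sphere_subset_closedBall hx) hx1).le, zero_smul, add_zero]

lemma exists_fixedPoint_of_forall_exists_dist_le {X : Type*} [MetricSpace X] {K : Set X}
    {f : X → X} (hK : IsCompact K) (hf : ContinuousOn f K)
    (happrox : ∀ ε > 0, ∃ x ∈ K, dist (f x) x ≤ ε) : ∃ x ∈ K, f x = x := by
  obtain ⟨x₁, hx₁, -⟩ := happrox 1 one_pos
  obtain ⟨x, hx, hmin⟩ := hK.exists_isMinOn ⟨x₁, hx₁⟩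
    (continuous_dist.comp_continuousOn (hf.prodMk continuousOn_id))
  refine ⟨x, hx, dist_le_zero.1 (le_of_forall_pos_le_add fun ε hε ↦ ?_)⟩
  obtain ⟨y, hy, hdist⟩ := happrox ε hε
  rw [zero_add]
  exact (hmin hy).trans hdist

theorem exists_fixedPoint_of_mapsTo_closedBall [FiniteDimensional ℝ E] {f : E → E}
    (hf : ContinuousOn f (closedBall 0 1)) (hmaps : MapsTo f (closedBall 0 1) (closedBall 0 1)) :
    ∃ x ∈ closedBall (0 : E) 1, f x = x := by
  refine exists_fixedPoint_of_forall_exists_dist_le (isCompact_closedBall _ _) hf fun ε hε ↦ ?_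
  let proj : E → E := fun x ↦ (max 1 ‖x‖)⁻¹ • x
  have hproj_mem (x) : proj x ∈ closedBall (0 : E) 1 := by
    rw [mem_closedBall_zero_iff, norm_smul, Real.norm_of_nonneg (by positivity),
      inv_mul_le_one₀ (by positivity)]
    exact le_max_right _ _
  have hproj_id (x) (hx : x ∈ closedBall (0 : E) 1) : proj x = x := by
    simp [proj, max_eq_left (mem_closedBall_zero_iff.1 hx)]
  have hproj : Continuous proj :=
    (Continuous.inv₀ (by fun_prop) fun x ↦ by positivity).smul continuous_id
  obtain ⟨g, hg, hgf, -⟩ := (hf.comp_continuous hproj hproj_mem).exists_contDiff_approx 1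
    (ε := fun _ ↦ ε / 2) continuous_const fun _ ↦ half_pos hε
  have hgnorm (x) : ‖g x‖ ≤ 1 + ε / 2 := by
    have hf1 := mem_closedBall_zero_iff.1 (hmaps (hproj_mem x))
    have hclose : ‖g x - f (proj x)‖ < ε / 2 := dist_eq_norm (g x) (f (proj x)) ▸ hgf x
    linarith [norm_le_insert' (g x) (f (proj x))]
  obtain ⟨x, hx, hfix⟩ := exists_fixedPoint_of_contDiff (f := fun x ↦ (1 + ε / 2)⁻¹ • g x)
    (contDiff_const.smul (mod_cast hg)) fun x _ ↦ by
      rw [mem_closedBall_zero_iff, norm_smul, Real.norm_of_nonneg (by positivity),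
        inv_mul_le_one₀ (by positivity)]
      exact hgnorm x
  refine ⟨x, hx, ?_⟩
  have hgx : g x = x + (ε / 2) • x := by
    simpa [add_smul] using (inv_smul_eq_iff₀ (by positivity : 1 + ε / 2 ≠ 0)).1 hfix
  calc dist (f x) x ≤ dist (f (proj x)) (g x) + dist (g x) x := by
        rw [hproj_id x hx]; exact dist_triangle _ _ _
    _ ≤ ε / 2 + ε / 2 * 1 := by
        refine add_le_add (dist_comm (f _) (g x) ▸ (hgf x).le) ?_
        rw [hgx, dist_self_add_left, norm_smul, Real.norm_of_nonneg (half_pos hε).le]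
        exact mul_le_mul_of_nonneg_left (mem_closedBall_zero_iff.1 hx) (half_pos hε).le
    _ = ε := by ring

end Brouwer

/-! ### Schauder's fixed point theorem -/

section Schauder

open Metric

section Simplex

variable {ι : Type*} [Fintype ι]

/-- A continuous retraction of `ι → ℝ` onto the standard simplex: the positive parts of the
coordinates are scaled down if their sum exceeds `1`, and the missing mass is distributed uniformly
if it is below `1`. -/
def simplexRetraction (s : ι → ℝ) (i : ι) : ℝ :=
  (max (s i) 0 + (max 1 (∑ j, max (s j) 0) - ∑ j, max (s j) 0) / Fintype.card ι) /
    max 1 (∑ j, max (s j) 0)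

lemma continuous_simplexRetraction : Continuous (simplexRetraction (ι := ι)) := by
  refine continuous_pi fun i ↦ Continuous.div ?_ ?_ fun s ↦ ?_
  · fun_prop
  · fun_prop
  · positivity

lemma simplexRetraction_mem [Nonempty ι] (s : ι → ℝ) : simplexRetraction s ∈ stdSimplex ℝ ι := by
  have hle : ∑ j, max (s j) 0 ≤ max 1 (∑ j, max (s j) 0) := le_max_right _ _
  refine ⟨fun i ↦ ?_, ?_⟩
  · have : 0 ≤ max 1 (∑ j, max (s j) 0) - ∑ j, max (s j) 0 := sub_nonneg.2 hle
    unfold simplexRetraction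
    positivity
  · unfold simplexRetraction
    rw [← Finset.sum_div, Finset.sum_add_distrib, Finset.sum_const, Finset.card_univ,
      nsmul_eq_mul, mul_div_cancel₀ _ (by positivity), add_sub_cancel, div_self (by positivity)]

lemma simplexRetraction_eq_self {s : ι → ℝ} (hs : s ∈ stdSimplex ℝ ι) :
    simplexRetraction s = s := by
  funext i
  simp [simplexRetraction, max_eq_left (hs.1 _), hs.2]

lemma norm_toLp_le_one_of_mem_stdSimplex {s : ι → ℝ} (hs : s ∈ stdSimplex ℝ ι) :
    ‖WithLp.toLp 2 s‖ ≤ 1 := by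
  rw [EuclideanSpace.norm_eq, Real.sqrt_le_one, ← hs.2]
  refine Finset.sum_le_sum fun i _ ↦ ?_
  have hle : s i ≤ 1 := hs.2 ▸ Finset.single_le_sum (fun j _ ↦ hs.1 j) (Finset.mem_univ i)
  rw [Real.norm_of_nonneg (hs.1 i)]
  exact pow_le_of_le_one (hs.1 i) hle two_ne_zero

theorem exists_fixedPoint_of_mapsTo_stdSimplex [Nonempty ι] {f : (ι → ℝ) → ι → ℝ}
    (hf : ContinuousOn f (stdSimplex ℝ ι)) (hmaps : MapsTo f (stdSimplex ℝ ι) (stdSimplex ℝ ι)) :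
    ∃ s ∈ stdSimplex ℝ ι, f s = s := by
  let F : EuclideanSpace ℝ ι → EuclideanSpace ℝ ι := fun s ↦
    WithLp.toLp 2 (f (simplexRetraction s.ofLp))
  have hF : Continuous F := (PiLp.continuous_toLp 2 _).comp <|
    hf.comp_continuous (continuous_simplexRetraction.comp (PiLp.continuous_ofLp 2 _))
      fun s ↦ simplexRetraction_mem _
  obtain ⟨s, -, hs⟩ := exists_fixedPoint_of_mapsTo_closedBall hF.continuousOn fun s _ ↦
    mem_closedBall_zero_iff.2
      (norm_toLp_le_one_of_mem_stdSimplex (hmaps (simplexRetraction_mem s.ofLp)))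
  have hs' : f (simplexRetraction s.ofLp) = s.ofLp := congrArg WithLp.ofLp hs
  have hmem : s.ofLp ∈ stdSimplex ℝ ι := hs' ▸ hmaps (simplexRetraction_mem _)
  exact ⟨s.ofLp, hmem, by rwa [simplexRetraction_eq_self hmem] at hs'⟩

end Simplex

variable {X : Type*} [NormedAddCommGroup X] [NormedSpace ℝ X]

lemma exists_dist_le_of_isCompact_convex {K : Set X} (hK : IsCompact K) (hconv : Convex ℝ K)
    (hne : K.Nonempty) {f : X → X} (hf : ContinuousOn f K) (hmaps : MapsTo f K K) {ε : ℝ}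
    (hε : 0 < ε) : ∃ x ∈ K, dist (f x) x ≤ ε := by
  obtain ⟨t, htK, hfin, hcover⟩ := hK.finite_cover_balls hε
  have : Fintype t := hfin.fintype
  have : Nonempty t := by
    obtain ⟨x, hx⟩ := hne
    obtain ⟨y, hy, -⟩ := mem_iUnion₂.1 (hcover hx)
    exact ⟨⟨y, hy⟩⟩
  obtain ⟨φ, hφ⟩ := PartitionOfUnity.exists_isSubordinate_of_locallyFinite hK.isClosed
    (fun i : t ↦ ball (i : X) ε) (fun i ↦ isOpen_ball) (locallyFinite_of_finite _)
    (hcover.trans (biUnion_eq_iUnion t fun x _ ↦ ball x ε).subset)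
  let combine : (t → ℝ) → X := fun s ↦ ∑ i, s i • (i : X)
  have hcombine (s) (hs : s ∈ stdSimplex ℝ t) : combine s ∈ K :=
    hconv.sum_mem (fun i _ ↦ hs.1 i) hs.2 fun i _ ↦ htK i.2
  have hcont : ContinuousOn (f ∘ combine) (stdSimplex ℝ t) :=
    hf.comp (by fun_prop) hcombine
  obtain ⟨s, hs, hfix⟩ := exists_fixedPoint_of_mapsTo_stdSimplex
    (f := fun s i ↦ φ i (f (combine s)))
    (continuousOn_pi.2 fun i ↦ (φ i).continuous.comp_continuousOn hcont) fun s hs ↦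
      ⟨fun i ↦ φ.nonneg i _, by
        rw [← finsum_eq_sum_of_fintype, φ.sum_eq_one (hmaps (hcombine s hs))]⟩
  refine ⟨combine s, hcombine s hs, ?_⟩
  have hmem : ∑ᶠ i : t, φ i (f (combine s)) • (i : X) ∈ closedBall (f (combine s)) ε :=
    φ.finsum_smul_mem_convex (g := fun i _ ↦ (i : X)) (hmaps (hcombine s hs))
      (fun i hi ↦ ball_subset_closedBall (mem_ball_comm.1 (hφ i (subset_tsupport _ hi))))
      (convex_closedBall _ _)
  rw [finsum_eq_sum_of_fintype] at hmem
  rw [dist_comm]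
  convert mem_closedBall.1 hmem using 2
  exact Finset.sum_congr rfl fun i _ ↦ by rw [← congrFun hfix i]

theorem exists_fixedPoint_of_isCompact_convex {K : Set X} (hK : IsCompact K) (hconv : Convex ℝ K)
    (hne : K.Nonempty) {f : X → X} (hf : ContinuousOn f K) (hmaps : MapsTo f K K) :
    ∃ x ∈ K, f x = x :=
  exists_fixedPoint_of_forall_exists_dist_le hK hf fun _ hε ↦
    exists_dist_le_of_isCompact_convex hK hconv hne hf hmaps hε

end Schauder

/-! ### Multipoint boundary value problems -/

section MultipointProblem

open MeasureTheory Metric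
open scoped NNReal

section LipschitzBall

variable {Y V : Type*} [PseudoMetricSpace Y] [NormedAddCommGroup V]

/-- The set of `L`-Lipschitz maps with norm at most `R`: the invariant set of the Picard operator
to which Schauder's theorem is applied. -/
def lipschitzBall (Y V : Type*) [PseudoMetricSpace Y] [NormedAddCommGroup V] (R : ℝ) (L : ℝ≥0) :
    Set C(Y, V) :=
  {x | (∀ t, ‖x t‖ ≤ R) ∧ LipschitzWith L x}

lemma isCompact_lipschitzBall [CompactSpace Y] [ProperSpace V] (R : ℝ) (L : ℝ≥0) :
    IsCompact (lipschitzBall Y V R L) := by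
  refine ArzelaAscoli.isCompact_of_equicontinuous _ ?_
    (LipschitzWith.uniformEquicontinuous _ L fun x ↦ x.2.2).equicontinuous
  have himage : ContinuousMap.toFun '' lipschitzBall Y V R L =
      (univ.pi fun _ ↦ closedBall 0 R) ∩ {x | LipschitzWith L x} := by
    ext x
    constructor
    · rintro ⟨y, ⟨hnorm, hlip⟩, rfl⟩
      exact ⟨fun t _ ↦ mem_closedBall_zero_iff.2 (hnorm t), hlip⟩
    · rintro ⟨hnorm, hlip⟩
      exact ⟨⟨x, hlip.continuous⟩,
        ⟨fun t ↦ mem_closedBall_zero_iff.1 (hnorm t (mem_univ t)), hlip⟩, rfl⟩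
  rw [himage]
  exact (isCompact_univ_pi fun _ ↦ isCompact_closedBall _ _).inter_right
    (isClosed_setOfPred_lipschitzWith L)

lemma convex_lipschitzBall [NormedSpace ℝ V] (R : ℝ) (L : ℝ≥0) :
    Convex ℝ (lipschitzBall Y V R L) := by
  rintro x ⟨hx, hxL⟩ y ⟨hy, hyL⟩ a b ha hb hab
  refine ⟨fun t ↦ ?_, ?_⟩
  · exact mem_closedBall_zero_iff.1 (convex_closedBall (0 : V) R
      (mem_closedBall_zero_iff.2 (hx t)) (mem_closedBall_zero_iff.2 (hy t)) ha hb hab)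
  · have hlip := ((lipschitzWith_smul a).comp hxL).add ((lipschitzWith_smul b).comp hyL)
    have hsum : ‖a‖₊ + ‖b‖₊ = 1 := NNReal.eq <| by
      simp [abs_of_nonneg ha, abs_of_nonneg hb, hab]
    rwa [← add_mul, hsum, one_mul] at hlip

lemma lipschitzBall_nonempty {R : ℝ} (hR : 0 ≤ R) (L : ℝ≥0) : (lipschitzBall Y V R L).Nonempty :=
  ⟨0, fun _ ↦ norm_zero.trans_le hR, LipschitzWith.const' 0⟩

end LipschitzBall

section Picard

variable {ι : Type*} {G : ℝ → (ι → ℝ) → ι → ℝ} {t₀ x₀ : ι → ℝ}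

/-- The Picard operator of `x' = G t x`, where the component `i` is prescribed at time `t₀ i`. -/
def picard (G : ℝ → (ι → ℝ) → ι → ℝ) (t₀ x₀ : ι → ℝ) (x : ℝ → ι → ℝ) (t : ℝ) (i : ι) : ℝ :=
  x₀ i + ∫ s in t₀ i..t, G s (x s) i

lemma hasDerivAt_picard (hG : Continuous (Function.uncurry G)) {x : ℝ → ι → ℝ}
    (hx : Continuous x) (t : ℝ) (i : ι) :
    HasDerivAt (fun s ↦ picard G t₀ x₀ x s i) (G t (x t) i) t := by
  have hcont : Continuous fun s ↦ G s (x s) i :=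
    (continuous_apply i).comp (hG.comp (continuous_id.prodMk hx))
  exact (hcont.integral_hasStrictDerivAt _ t).hasDerivAt.const_add _

lemma continuous_picard {Z : Type*} [TopologicalSpace Z] (hG : Continuous (Function.uncurry G))
    {x : Z → ℝ → ι → ℝ} (hx : Continuous (Function.uncurry x)) :
    Continuous fun z : Z × ℝ ↦ picard G t₀ x₀ (x z.1) z.2 := by
  refine continuous_pi fun i ↦ continuous_const.add <|
    intervalIntegral.continuous_parametric_intervalIntegral_of_continuous
      (f := fun (z : Z × ℝ) s ↦ G s (x z.1 s) i) ?_ continuous_snd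
  have hpair : Continuous fun w : (Z × ℝ) × ℝ ↦ (w.2, x w.1.1 w.2) :=
    continuous_snd.prodMk (hx.comp ((continuous_fst.comp continuous_fst).prodMk continuous_snd))
  exact (continuous_apply i).comp (hG.comp hpair)

lemma lipschitzWith_picard_apply (hG : Continuous (Function.uncurry G)) {L : ℝ≥0}
    (hL : ∀ t x i, ‖G t x i‖ ≤ L) {x : ℝ → ι → ℝ} (hx : Continuous x) (i : ι) :
    LipschitzWith L fun t ↦ picard G t₀ x₀ x t i :=
  lipschitzWith_of_nnnorm_deriv_le (fun t ↦ (hasDerivAt_picard hG hx t i).differentiableAt)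
    fun t ↦ by rw [(hasDerivAt_picard hG hx t i).deriv]; exact hL t (x t) i

lemma picard_mem_lipschitzBall [Fintype ι] {a b : ℝ} (hG : Continuous (Function.uncurry G))
    {L : ℝ≥0} (hL : ∀ t x i, ‖G t x i‖ ≤ L) (ht₀ : ∀ i, t₀ i ∈ Icc a b) {x : ℝ → ι → ℝ}
    (hx : Continuous x) {y : C(Icc a b, ι → ℝ)} (hy : ∀ t, y t = picard G t₀ x₀ x t) :
    y ∈ lipschitzBall (Icc a b) (ι → ℝ) (‖x₀‖ + L * (b - a)) L := by
  refine ⟨fun t ↦ ?_, LipschitzWith.of_dist_le_mul fun s t ↦ ?_⟩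
  · have hab : 0 ≤ b - a := sub_nonneg.2 (t.2.1.trans t.2.2)
    refine (pi_norm_le_iff_of_nonneg (by positivity)).2 fun i ↦ ?_
    have hdist :=
      (lipschitzWith_picard_apply (t₀ := t₀) (x₀ := x₀) hG hL hx i).dist_le_mul t (t₀ i)
    have hstart : picard G t₀ x₀ x (t₀ i) i = x₀ i := by simp [picard]
    rw [hstart, ← hy, dist_eq_norm] at hdist
    calc ‖y t i‖ ≤ ‖x₀ i‖ + ‖y t i - x₀ i‖ := norm_le_insert' _ _
      _ ≤ ‖x₀‖ + L * (b - a) := by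
        gcongr
        · exact norm_le_pi_norm x₀ i
        · exact hdist.trans (by gcongr; exact Real.dist_le_of_mem_Icc t.2 (ht₀ i))
  · rw [hy, hy]
    exact (dist_pi_le_iff (by positivity)).2 fun i ↦
      (lipschitzWith_picard_apply hG hL hx i).dist_le_mul s t

end Picard

/-- `x` solves `(x i)' = F t x i` on `[a, b]`, with `x i` prescribed at time `t₀ i`, for every index
`i` in `S`. The components outside `S` are parameters of the system. -/
structure IsMultipointSolution {α : Type*} (S : Finset α) (a b : ℝ) (F : ℝ → (α → ℝ) → α → ℝ)
    (t₀ x₀ : α → ℝ) (x : ℝ → α → ℝ) : Prop where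
  eq_at : ∀ i ∈ S, x (t₀ i) i = x₀ i
  hasDeriv : ∀ i ∈ S, ∀ t ∈ Icc a b, HasDerivWithinAt (fun s ↦ x s i) (F t (x t) i) (Icc a b) t

theorem exists_isMultipointSolution_of_bounded {ι : Type*} [Fintype ι] {a b : ℝ} (hab : a ≤ b)
    {G : ℝ → (ι → ℝ) → ι → ℝ} (hG : Continuous (Function.uncurry G)) {L : ℝ≥0}
    (hL : ∀ t x i, ‖G t x i‖ ≤ L) {t₀ : ι → ℝ} (ht₀ : ∀ i, t₀ i ∈ Icc a b) (x₀ : ι → ℝ) :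
    ∃ x, Continuous x ∧ IsMultipointSolution Finset.univ a b G t₀ x₀ x := by
  let ext : C(Icc a b, ι → ℝ) → ℝ → ι → ℝ := fun x t ↦ x (projIcc a b hab t)
  have hext : Continuous (Function.uncurry ext) :=
    continuous_eval.comp <|
      continuous_fst.prodMk ((continuous_projIcc (h := hab)).comp continuous_snd)
  have hextx (x) : Continuous (ext x) := hext.comp (continuous_const.prodMk continuous_id)
  have hpicard := continuous_picard (t₀ := t₀) (x₀ := x₀) hG hext
  let Φ : C(Icc a b, ι → ℝ) → C(Icc a b, ι → ℝ) := fun x ↦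
    ⟨fun t ↦ picard G t₀ x₀ (ext x) t,
      hpicard.comp (continuous_const.prodMk continuous_subtype_val)⟩
  have hΦ : Continuous Φ := ContinuousMap.continuous_of_continuous_uncurry _
    (hpicard.comp (continuous_fst.prodMk (continuous_subtype_val.comp continuous_snd)))
  obtain ⟨x, -, hfix⟩ := exists_fixedPoint_of_isCompact_convex
    (isCompact_lipschitzBall (Y := Icc a b) (V := ι → ℝ) _ L) (convex_lipschitzBall _ L)
    (lipschitzBall_nonempty
      (add_nonneg (norm_nonneg x₀) (mul_nonneg L.2 (sub_nonneg.2 hab))) L) hΦ.continuousOn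
    fun x _ ↦ picard_mem_lipschitzBall hG hL ht₀ (hextx x) fun _ ↦ rfl
  have heq (t) (ht : t ∈ Icc a b) : ext x t = picard G t₀ x₀ (ext x) t := calc
    ext x t = Φ x ⟨t, ht⟩ := by rw [hfix]; simp only [ext, projIcc_of_mem hab ht]
    _ = picard G t₀ x₀ (ext x) t := rfl
  refine ⟨ext x, hextx x, fun i _ ↦ ?_, fun i _ t ht ↦ ?_⟩
  · rw [heq _ (ht₀ i)]
    simp [picard]
  · exact (hasDerivAt_picard hG (hextx x) t i).hasDerivWithinAt.congr
      (fun s hs ↦ congrFun (heq s hs) i) (congrFun (heq t ht) i)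

lemma exists_forall_norm_le_of_isCompact {X α : Type*} [TopologicalSpace X] {s : Set X}
    (hs : IsCompact s) (S : Finset α) {u : X → α → ℝ}
    (hu : ∀ i ∈ S, ContinuousOn (fun x ↦ u x i) s) :
    ∃ L : ℝ≥0, ∀ i ∈ S, ∀ x ∈ s, ‖u x i‖ ≤ L := by
  have hbound (i) (hi : i ∈ S) := hs.exists_bound_of_continuousOn (hu i hi)
  choose! L hL using hbound
  refine ⟨S.sup fun i ↦ (L i).toNNReal, fun i hi x hx ↦ ?_⟩
  exact ((hL i hi x hx).trans (Real.le_coe_toNNReal _)).trans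
    (mod_cast Finset.le_sup (f := fun i ↦ (L i).toNNReal) hi)

theorem exists_isMultipointSolution_of_apriori_bound {α : Type*} (S : Finset α) {a b : ℝ}
    (hab : a ≤ b) {F : ℝ → (α → ℝ) → α → ℝ} {lo hi : α → ℝ} (hlohi : lo ≤ hi)
    (hF : ∀ i ∈ S, ContinuousOn (fun z : ℝ × (α → ℝ) ↦ F z.1 z.2 i) (Icc a b ×ˢ Icc lo hi))
    {t₀ : α → ℝ} (ht₀ : ∀ i ∈ S, t₀ i ∈ Icc a b) (x₀ : α → ℝ)
    (hbound : ∀ x, IsMultipointSolution S a b (fun t y ↦ F t (lo ⊔ hi ⊓ y)) t₀ x₀ x →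
      ∀ i ∈ S, ∀ t ∈ Icc a b, x t i ∈ Icc (lo i) (hi i)) :
    ∃ x : ℝ → α → ℝ, Continuous x ∧ (∀ i ∈ S, ∀ t ∈ Icc a b, x t i ∈ Icc (lo i) (hi i)) ∧
      IsMultipointSolution S a b F t₀ x₀ x := by
  classical
  let ext : (S → ℝ) → α → ℝ := fun y i ↦ if h : i ∈ S then y ⟨i, h⟩ else lo i
  have hext : Continuous ext := continuous_pi fun i ↦ by
    by_cases h : i ∈ S
    · simpa only [ext, h, dite_true] using continuous_apply _
    · simpa only [ext, h, dite_false] using continuous_const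
  have hext_mem (y) (i) (h : i ∈ S) : ext y i = y ⟨i, h⟩ := dif_pos h
  let box : ℝ × (S → ℝ) → ℝ × (α → ℝ) := fun z ↦ (projIcc a b hab z.1, lo ⊔ hi ⊓ ext z.2)
  have hbox_mem (z) : box z ∈ Icc a b ×ˢ Icc lo hi :=
    ⟨Subtype.prop _, le_sup_left, sup_le hlohi inf_le_left⟩
  have hbox : Continuous box := (continuous_subtype_val.comp
    (continuous_projIcc.comp continuous_fst)).prodMk <| continuous_pi fun j ↦
      continuous_const.max (continuous_const.min
        ((continuous_apply j).comp (hext.comp continuous_snd)))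
  obtain ⟨L, hL⟩ :=
    exists_forall_norm_le_of_isCompact (isCompact_Icc.prod isCompact_Icc) S hF
  obtain ⟨y, hy, hysol⟩ := exists_isMultipointSolution_of_bounded hab
    (G := fun t y i ↦ F (box (t, y)).1 (box (t, y)).2 i)
    (continuous_pi fun i : S ↦ (hF i i.2).comp_continuous hbox hbox_mem)
    (fun t y i ↦ hL i i.2 _ (hbox_mem (t, y)))
    (t₀ := fun i ↦ t₀ i) (fun i ↦ ht₀ i i.2) fun i ↦ x₀ i
  have htrunc : IsMultipointSolution S a b (fun t y ↦ F t (lo ⊔ hi ⊓ y)) t₀ x₀ (ext ∘ y) := by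
    refine ⟨fun i hi ↦ ?_, fun i hi t ht ↦ ?_⟩
    · exact (hext_mem _ i hi).trans (hysol.eq_at ⟨i, hi⟩ (Finset.mem_univ _))
    · simpa only [Function.comp_apply, hext_mem _ i hi, box, projIcc_of_mem hab ht] using
        hysol.hasDeriv ⟨i, hi⟩ (Finset.mem_univ _) t ht
  refine ⟨ext ∘ y, hext.comp hy, hbound _ htrunc, htrunc.eq_at, fun i hiS t ht ↦ ?_⟩
  have hfix : lo ⊔ hi ⊓ ext (y t) = ext (y t) := by
    refine funext fun j ↦ ?_
    by_cases hj : j ∈ S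
    · have hmem := hbound _ htrunc j hj t ht
      exact (congrArg (lo j ⊔ ·) (inf_eq_right.2 hmem.2)).trans (sup_eq_right.2 hmem.1)
    · have : ext (y t) j = lo j := dif_neg hj
      simp [this, hlohi j]
  simpa only [Function.comp_apply, hfix] using htrunc.hasDeriv i hiS t ht

end MultipointProblem

/-! ### Maximum principle for finite families of functions -/

section MaximumPrinciple

variable {a b B C : ℝ} {f f' : ℝ → ℝ}

lemma deriv_nonpos_of_isMaxOn_Icc {d t : ℝ} (ht : t ∈ Ico a b)
    (hd : HasDerivWithinAt f d (Icc a b) t) (hmax : IsMaxOn f (Icc a b) t) : d ≤ 0 := by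
  have hcone : b - t ∈ posTangentConeAt (Icc a b) t := mem_posTangentConeAt_of_segment_subset <| by
    rw [add_sub_cancel, segment_eq_Icc ht.2.le]
    exact Icc_subset_Icc_left ht.1
  have hle : (b - t) * d ≤ 0 := by
    simpa using hmax.localize.hasFDerivWithinAt_nonpos hd.hasFDerivWithinAt hcone
  exact nonpos_of_mul_nonpos_right hle (sub_pos.2 ht.2)

variable {α : Type*} (S : Finset α) {u u' : ℝ → α → ℝ}

lemma le_of_deriv_gt_at_argmax
    (hd : ∀ t ∈ Icc a b, ∀ i ∈ S, HasDerivWithinAt (fun s ↦ u s i) (u' t i) (Icc a b) t)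
    (hB : ∀ i ∈ S, u b i ≤ B)
    (h : ∀ t ∈ Icc a b, ∀ i ∈ S, (∀ j ∈ S, u t j ≤ u t i) → -C < u' t i) :
    ∀ t ∈ Icc a b, ∀ i ∈ S, u t i ≤ B + C * (b - t) := by
  intro t₁ ht₁ i₁ hi₁
  let v : ℝ → α → ℝ := fun t i ↦ u t i - C * (b - t)
  have hv (t) (ht : t ∈ Icc a b) (i) (hi : i ∈ S) :
      HasDerivWithinAt (fun s ↦ v s i) (u' t i + C) (Icc a b) t := by
    simpa using (hd t ht i hi).fun_sub (((hasDerivWithinAt_id t _).const_sub b).const_mul C)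
  have hmax (i) (hi : i ∈ S) : ∃ t ∈ Icc a b, IsMaxOn (fun s ↦ v s i) (Icc a b) t :=
    isCompact_Icc.exists_isMaxOn ⟨t₁, ht₁⟩ fun t ht ↦ (hv t ht i hi).continuousWithinAt
  choose! τ hτ hτmax using hmax
  obtain ⟨i, hi, himax⟩ := S.exists_max_image (fun i ↦ v (τ i) i) ⟨i₁, hi₁⟩
  have hle (t) (ht : t ∈ Icc a b) (j) (hj : j ∈ S) : v t j ≤ v (τ i) i :=
    (hτmax j hj ht).trans (himax j hj)
  have hτb : τ i = b := by
    by_contra hne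
    have hderiv := deriv_nonpos_of_isMaxOn_Icc ⟨(hτ i hi).1, (hτ i hi).2.lt_of_ne hne⟩
      (hv _ (hτ i hi) i hi) (hτmax i hi)
    have hargmax (j) (hj : j ∈ S) : u (τ i) j ≤ u (τ i) i :=
      (sub_le_sub_iff_right _).1 (hle _ (hτ i hi) j hj)
    linarith [h _ (hτ i hi) i hi hargmax]
  have hglobal := hle t₁ ht₁ i₁ hi₁
  simp only [v, hτb, sub_self, mul_zero, sub_zero] at hglobal
  linarith [hB i hi]

theorem le_of_deriv_ge_at_argmax
    (hd : ∀ t ∈ Icc a b, ∀ i ∈ S, HasDerivWithinAt (fun s ↦ u s i) (u' t i) (Icc a b) t)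
    (hB : ∀ i ∈ S, u b i ≤ B)
    (h : ∀ t ∈ Icc a b, ∀ i ∈ S, (∀ j ∈ S, u t j ≤ u t i) → -C ≤ u' t i) :
    ∀ t ∈ Icc a b, ∀ i ∈ S, u t i ≤ B + C * (b - t) := by
  intro t ht i hi
  have hlim : Filter.Tendsto (fun c ↦ B + c * (b - t)) (nhdsWithin C (Ioi C))
      (nhds (B + C * (b - t))) :=
    (Continuous.tendsto (by fun_prop) C).mono_left nhdsWithin_le_nhds
  refine ge_of_tendsto hlim (Filter.eventually_of_mem self_mem_nhdsWithin fun c (hc : C < c) ↦ ?_)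
  exact le_of_deriv_gt_at_argmax S hd hB
    (fun t ht i hi hmax ↦ (neg_lt_neg hc).trans_le (h t ht i hi hmax)) t ht i hi

theorem abs_le_of_signed_deriv_ge_at_argmax
    (hd : ∀ t ∈ Icc a b, ∀ i ∈ S, HasDerivWithinAt (fun s ↦ u s i) (u' t i) (Icc a b) t)
    (hzero : ∀ i ∈ S, u b i = 0)
    (h : ∀ s : ℝ, |s| = 1 → ∀ t ∈ Icc a b, ∀ i ∈ S,
      (∀ j ∈ S, s * u t j ≤ s * u t i) → -C ≤ s * u' t i) :
    ∀ t ∈ Icc a b, ∀ i ∈ S, |u t i| ≤ C * (b - t) := by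
  intro t ht i hi
  have hsigned (s : ℝ) (hs : |s| = 1) : s * u t i ≤ C * (b - t) := by
    simpa using le_of_deriv_ge_at_argmax S (B := 0)
      (fun t ht i hi ↦ (hd t ht i hi).const_mul s) (fun i hi ↦ by simp [hzero i hi])
      (h s hs) t ht i hi
  exact abs_le'.2 ⟨by simpa using hsigned 1 (by simp), by simpa using hsigned (-1) (by simp)⟩

lemma nonneg_of_deriv_nonneg_of_neg
    (hd : ∀ t ∈ Icc a b, HasDerivWithinAt f (f' t) (Icc a b) t) (ha : 0 ≤ f a)
    (h : ∀ t ∈ Icc a b, f t < 0 → 0 ≤ f' t) : ∀ t ∈ Icc a b, 0 ≤ f t := by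
  intro t ht
  have hbound (ε : ℝ) (hε : 0 < ε) : -f t ≤ ε * (1 + (t - a)) := by
    refine image_le_of_deriv_right_lt_deriv_boundary (f := fun s ↦ -f s) (f' := fun s ↦ -f' s)
      (B := fun s ↦ ε * (1 + (s - a))) (B' := fun _ ↦ ε)
      (fun s hs ↦ (hd s hs).continuousWithinAt.neg)
      (fun s hs ↦ ((hd s (Ico_subset_Icc_self hs)).mono_of_mem_nhdsWithin
        (Icc_mem_nhdsGE_of_mem hs)).neg) ?_ (fun s ↦ ?_) (fun s hs heq ↦ ?_) ht
    · simp only [sub_self, add_zero, mul_one]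
      linarith
    · simpa using (((hasDerivAt_id s).sub_const a).const_add 1).const_mul ε
    · have hpos : 0 < ε * (1 + (s - a)) := mul_pos hε (by linarith [hs.1])
      linarith [h s (Ico_subset_Icc_self hs) (by linarith)]
  have hlim : Filter.Tendsto (fun ε : ℝ ↦ ε * (1 + (t - a))) (nhdsWithin 0 (Ioi 0))
      (nhds (0 * (1 + (t - a)))) :=
    (Continuous.tendsto (by fun_prop) 0).mono_left nhdsWithin_le_nhds
  have hle := ge_of_tendsto hlim (Filter.eventually_of_mem self_mem_nhdsWithin hbound)
  linarith

lemma eq_left_of_hasDerivWithinAt_zero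
    (hd : ∀ t ∈ Icc a b, HasDerivWithinAt f 0 (Icc a b) t) : ∀ t ∈ Icc a b, f t = f a :=
  constant_of_has_deriv_right_zero (fun t ht ↦ (hd t ht).continuousWithinAt) fun t ht ↦
    (hd t (Ico_subset_Icc_self ht)).mono_of_mem_nhdsWithin (Icc_mem_nhdsGE_of_mem ht)

lemma contDiffOn_one_of_hasDerivWithinAt {s : Set ℝ} (hs : UniqueDiffOn ℝ s)
    (hd : ∀ t ∈ s, HasDerivWithinAt f (f' t) s t) (hf' : ContinuousOn f' s) :
    ContDiffOn ℝ 1 f s :=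
  (contDiffOn_one_iff_derivWithin hs).2 ⟨fun t ht ↦ (hd t ht).differentiableWithinAt,
    hf'.congr fun t ht ↦ (hd t ht).derivWithin (hs t ht)⟩

end MaximumPrinciple

/-! ### Feedback maps -/

section Feedback

variable {a : ℝ} {f : ℝ → ℝ}

/-- The Hamiltonian of an agent with intensity `x ↦ exp (-a x)` and feedback quote `f x`, where
`x` is the loss of value due to a trade. -/
def feedbackHamiltonian (a : ℝ) (f : ℝ → ℝ) (x : ℝ) : ℝ := Real.exp (-a * f x) * (f x - x)

/-- The admissible feedback maps: those which are continuous and whose Hamiltonian is bounded above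
on each half-line `[c, ∞)` and below on each half-line `(-∞, c]`. Both the optimal quotes and the
bounded ones are admissible. -/
structure IsFeedback (a : ℝ) (f : ℝ → ℝ) : Prop where
  continuous : Continuous f
  bddAbove : ∀ c, BddAbove (feedbackHamiltonian a f '' Ici c)
  bddBelow : ∀ c, BddBelow (feedbackHamiltonian a f '' Iic c)

namespace IsFeedback

lemma exists_signed_bound (hf : IsFeedback a f) (c : ℝ) :
    ∃ K, 0 ≤ K ∧ ∀ s x : ℝ, |s| = 1 → -c ≤ s * x → s * feedbackHamiltonian a f x ≤ K := by
  obtain ⟨K₁, hK₁⟩ := hf.bddAbove (-c)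
  obtain ⟨K₂, hK₂⟩ := hf.bddBelow c
  refine ⟨max 0 (max K₁ (-K₂)), le_max_left _ _, fun s x hs hx ↦ ?_⟩
  rcases eq_or_eq_neg_of_abs_eq hs with rfl | rfl
  · rw [one_mul] at hx ⊢
    exact (hK₁ (mem_image_of_mem _ hx)).trans (by simp)
  · have hK := hK₂ (mem_image_of_mem _ (show x ≤ c by linarith))
    exact (show _ ≤ -K₂ by linarith).trans (by simp)

lemma const_add (ha : 0 ≤ a) {e : ℝ} (he : 0 ≤ e) : IsFeedback a fun x ↦ e + x where
  continuous := by fun_prop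
  bddAbove c := by
    refine ⟨Real.exp (-a * (e + c)) * e, ?_⟩
    rintro _ ⟨x, hx : c ≤ x, rfl⟩
    simp only [feedbackHamiltonian, add_sub_cancel_right, neg_mul]
    gcongr
  bddBelow c := by
    refine ⟨0, ?_⟩
    rintro _ ⟨x, -, rfl⟩
    simp only [feedbackHamiltonian, add_sub_cancel_right]
    positivity

lemma of_abs_le (a : ℝ) (hf : Continuous f) {δ : ℝ} (hδ : ∀ x, |f x| ≤ δ) : IsFeedback a f := by
  have hexp (x : ℝ) : Real.exp (-a * f x) ≤ Real.exp (|a| * δ) := by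
    refine Real.exp_le_exp.2 ?_
    calc -a * f x ≤ |a| * |f x| := (le_abs_self _).trans_eq (by rw [abs_mul, abs_neg])
      _ ≤ |a| * δ := mul_le_mul_of_nonneg_left (hδ x) (abs_nonneg a)
  have hbound (x : ℝ) {y d : ℝ} (hy : y ≤ d) :
      Real.exp (-a * f x) * y ≤ Real.exp (|a| * δ) * |d| := calc
    _ ≤ Real.exp (-a * f x) * |d| :=
      mul_le_mul_of_nonneg_left (hy.trans (le_abs_self d)) (Real.exp_pos _).le
    _ ≤ Real.exp (|a| * δ) * |d| := mul_le_mul_of_nonneg_right (hexp x) (abs_nonneg d)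
  refine ⟨hf, fun c ↦ ⟨Real.exp (|a| * δ) * |δ - c|, ?_⟩,
    fun c ↦ ⟨-(Real.exp (|a| * δ) * |δ + c|), ?_⟩⟩
  · rintro _ ⟨x, hx : c ≤ x, rfl⟩
    exact hbound x (by linarith [le_of_abs_le (hδ x)])
  · rintro _ ⟨x, hx : x ≤ c, rfl⟩
    refine neg_le.1 ?_
    rw [feedbackHamiltonian, ← mul_neg]
    exact hbound x (by linarith [neg_le_of_abs_le (hδ x)])

end IsFeedback

end Feedback

/-! ### The market model -/

lemma mul_sum_neighbors_le {N q : ℤ} (hq : q ∈ Finset.Icc (-N) N) {s r₁ r₂ g₁ g₂ B₁ B₂ : ℝ}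
    (hB₁ : 0 ≤ B₁) (hB₂ : 0 ≤ B₂) (h₁ : q + 1 ∈ Finset.Icc (-N) N → s * (r₁ * g₁) ≤ B₁)
    (h₂ : q - 1 ∈ Finset.Icc (-N) N → s * (r₂ * g₂) ≤ B₂) :
    s * ((if q < N then 1 else 0) * r₁ * g₁ + (if -N < q then 1 else 0) * r₂ * g₂) ≤ B₁ + B₂ := by
  simp only [Finset.mem_Icc] at hq h₁ h₂
  rw [mul_add]
  refine add_le_add ?_ ?_
  · split_ifs with h
    · simpa using h₁ (by omega)
    · simpa using hB₁
  · split_ifs with h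
    · simpa using h₂ (by omega)
    · simpa using hB₂

lemma sum_Icc_sub_one (N : ℤ) (h : ℤ → ℝ) :
    ∑ q ∈ Finset.Icc (-N) N, (if -N < q then 1 else 0) * h (q - 1) =
      ∑ q ∈ Finset.Icc (-N) N, (if q < N then 1 else 0) * h q := by
  simp only [ite_mul, one_mul, zero_mul]
  rw [← Finset.sum_filter, ← Finset.sum_filter]
  refine Finset.sum_nbij' (fun q ↦ q - 1) (fun q ↦ q + 1) (fun q hq ↦ ?_) (fun q hq ↦ ?_)
    (fun q _ ↦ sub_add_cancel q 1) (fun q _ ↦ add_sub_cancel_right q 1) fun q _ ↦ rfl <;>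
  · simp only [Finset.mem_filter, Finset.mem_Icc] at hq ⊢
    omega

lemma sum_Icc_add_one (N : ℤ) (h : ℤ → ℝ) :
    ∑ q ∈ Finset.Icc (-N) N, (if q < N then 1 else 0) * h (q + 1) =
      ∑ q ∈ Finset.Icc (-N) N, (if -N < q then 1 else 0) * h q := by
  simpa only [sub_add_cancel] using (sum_Icc_sub_one N fun q ↦ h (q + 1)).symm

lemma abs_intCast_le_of_mem_Icc {N q : ℤ} (hq : q ∈ Finset.Icc (-N) N) : |(q : ℝ)| ≤ N := by
  rw [← Int.cast_abs]
  exact_mod_cast abs_le.2 (Finset.mem_Icc.1 hq)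

namespace MarketModel

section Clamp

variable {R x y : ℝ}

lemma continuous_clamp (R : ℝ) : Continuous (clamp R) :=
  continuous_const.max (continuous_const.min continuous_id)

lemma abs_clamp_le (hR : 0 ≤ R) (x : ℝ) : |clamp R x| ≤ R :=
  abs_le.2 ⟨le_max_left _ _, max_le (neg_le_self hR) (min_le_left _ _)⟩

lemma neg_le_mul_clamp_sub_clamp {s c : ℝ} (hs : |s| = 1) (hc : 0 ≤ c)
    (h : -c ≤ s * (x - y)) : -c ≤ s * (clamp R x - clamp R y) := by
  rcases eq_or_eq_neg_of_abs_eq hs with rfl | rfl <;>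
  · simp only [clamp, max_def, min_def]
    split_ifs <;> linarith

end Clamp

variable (M : MarketModel)

section Bounds

variable {f fm : ℝ → ℝ}

lemma Lamm_pos (x : ℝ) : 0 < M.Lamm x := mul_pos M.Am_pos (Real.exp_pos _)

lemma Lam_pos (x y : ℝ) : 0 < M.Lam x y := mul_pos M.A_pos (Real.exp_pos _)

lemma Lamm_mul_gain (fm : ℝ → ℝ) (z z' : ℝ) :
    M.Lamm (fm (z - z')) * gain (fm (z - z')) z z' =
      M.Am * feedbackHamiltonian (M.km / M.σ) fm (z - z') := by
  unfold Lamm gain feedbackHamiltonian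
  ring

lemma Lam_mul_gain (D : ℝ) (f : ℝ → ℝ) (z z' : ℝ) :
    M.Lam D (f (z - z')) * gain (f (z - z')) z z' =
      M.Lam D 0 * feedbackHamiltonian (M.k / M.σ) f (z - z') := by
  unfold Lam gain feedbackHamiltonian
  rw [add_zero, mul_add, Real.exp_add]
  ring

lemma mul_genSignal_nonpos {s : ℝ} {v : ℤ → ℝ} {b : ℤ} (hb : b ∈ M.gridB)
    (h : ∀ b' ∈ M.gridB, 0 ≤ s * (v b - v b')) :
    s * M.genSignal b (v b) (v (b + 1)) (v (b - 1)) ≤ 0 := by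
  have hterm {r : ℝ} (hr : 0 < r) {b' : ℤ} (hb' : b' ∈ M.gridB) : s * (r * (v b' - v b)) ≤ 0 := by
    nlinarith [mul_nonneg hr.le (h b' hb')]
  exact (mul_sum_neighbors_le hb le_rfl le_rfl (hterm M.lamPlus_pos)
    (hterm M.lamMinus_pos)).trans_eq (add_zero 0)

lemma exists_mul_hamTaker_le (hfm : IsFeedback (M.km / M.σ) fm) (c : ℝ) :
    ∃ B, 0 ≤ B ∧ ∀ (s : ℝ) (v : ℤ → ℝ), ∀ q ∈ M.gridQm, |s| = 1 →
      (∀ q' ∈ M.gridQm, -(c * |(q' : ℝ) - q|) ≤ s * (v q - v q')) →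
      s * M.hamTaker q (fm (v q - v (q + 1))) (fm (v q - v (q - 1)))
        (v q) (v (q + 1)) (v (q - 1)) ≤ B := by
  obtain ⟨K, hK₀, hK⟩ := hfm.exists_signed_bound c
  have hAK : 0 ≤ M.Am * K := mul_nonneg M.Am_pos.le hK₀
  refine ⟨M.Am * K + M.Am * K, add_nonneg hAK hAK, fun s v q hq hs h ↦ ?_⟩
  have hterm {q' : ℤ} (hq' : q' ∈ M.gridQm) (hdist : |(q' : ℝ) - q| = 1) :
      s * (M.Lamm (fm (v q - v q')) * gain (fm (v q - v q')) (v q) (v q')) ≤ M.Am * K := by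
    rw [Lamm_mul_gain, mul_left_comm]
    refine mul_le_mul_of_nonneg_left (hK s _ hs ?_) M.Am_pos.le
    simpa [hdist] using h q' hq'
  exact mul_sum_neighbors_le hq hAK hAK (hterm · (by simp)) (hterm · (by simp))

lemma exists_mul_hamMaker_le (hf : IsFeedback (M.k / M.σ) f) :
    ∃ K, 0 ≤ K ∧ ∀ (s : ℝ) (W : ℤ → ℝ) (δb δa π : ℤ → ℤ → ℝ), ∀ q ∈ M.gridQ, |s| = 1 →
      (∀ q' ∈ M.gridQ, 0 ≤ s * (W q - W q')) →
      s * M.hamMaker q (f (W q - W (q + 1))) (f (W q - W (q - 1)))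
        (W q) (W (q + 1)) (W (q - 1)) δb δa π ≤
        (M.Lam (M.integ δa π) 0 + M.Lam (M.integ δb π) 0) * K := by
  obtain ⟨K, hK₀, hK⟩ := hf.exists_signed_bound 0
  refine ⟨K, hK₀, fun s W δb δa π q hq hs h ↦ ?_⟩
  have hterm (D : ℝ) {q' : ℤ} (hq' : q' ∈ M.gridQ) :
      s * (M.Lam D (f (W q - W q')) * gain (f (W q - W q')) (W q) (W q')) ≤ M.Lam D 0 * K := by
    rw [Lam_mul_gain, mul_left_comm]
    exact mul_le_mul_of_nonneg_left (hK s _ hs (by simpa using h q' hq')) (M.Lam_pos D 0).le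
  rw [add_mul]
  exact mul_sum_neighbors_le hq (mul_nonneg (M.Lam_pos _ 0).le hK₀)
    (mul_nonneg (M.Lam_pos _ 0).le hK₀) (hterm _) (hterm _)

/-- The terms of the market-taker's equation which do not involve the permanent impact: the time
derivative of the value `v` when nobody else trades. -/
def takerDrift (fm : ℝ → ℝ) (v : ℤ → ℤ → ℝ) (q b : ℤ) : ℝ :=
  M.γ * M.σ ^ 2 * (q : ℝ) ^ 2 - (b : ℝ) * q - M.genSignal b (v q b) (v q (b + 1)) (v q (b - 1))
    - M.hamTaker q (fm (v q b - v (q + 1) b)) (fm (v q b - v (q - 1) b))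
        (v q b) (v (q + 1) b) (v (q - 1) b)

/-- The time derivative of the market-taker's value `v` prescribed by his equation, when `π` is the
law of the market-takers. -/
def takerField (fm : ℝ → ℝ) (v π : ℤ → ℤ → ℝ) (q b : ℤ) : ℝ :=
  M.takerDrift fm v q b - q * M.impact (takerBid fm v) (takerAsk fm v) π

/-- The time derivative of the market-maker's value `W` prescribed by his equation, when `δb` and
`δa` are the quotes of the market-takers and `π` is their law. -/
def makerField (f : ℝ → ℝ) (δb δa π : ℤ → ℤ → ℝ) (W : ℤ → ℝ) (q : ℤ) : ℝ :=
  M.φ * M.σ ^ 2 * (q : ℝ) ^ 2 - q * M.impact δb δa π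
    - M.hamMaker q (f (W q - W (q + 1))) (f (W q - W (q - 1))) (W q) (W (q + 1)) (W (q - 1))
        δb δa π

lemma exists_neg_le_mul_takerDrift (hfm : IsFeedback (M.km / M.σ) fm) (c : ℝ) :
    ∃ C, 0 ≤ C ∧ ∀ (s : ℝ) (v : ℤ → ℤ → ℝ), ∀ q ∈ M.gridQm, ∀ b ∈ M.gridB, |s| = 1 →
      (∀ q' ∈ M.gridQm, -(c * |(q' : ℝ) - q|) ≤ s * (v q b - v q' b)) →
      (∀ b' ∈ M.gridB, 0 ≤ s * (v q b - v q b')) → -C ≤ s * M.takerDrift fm v q b := by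
  obtain ⟨B, hB₀, hB⟩ := M.exists_mul_hamTaker_le hfm c
  have hqm : (0 : ℝ) < M.qmMax := mod_cast M.qmMax_pos
  have hbm : (0 : ℝ) < M.bMax := mod_cast M.bMax_pos
  have hγ := M.γ_pos
  refine ⟨M.γ * M.σ ^ 2 * (M.qmMax : ℝ) ^ 2 + M.bMax * M.qmMax + B, by positivity,
    fun s v q hq b hb hs hinv hsig ↦ ?_⟩
  have hham := hB s (fun q ↦ v q b) q hq hs hinv
  have hgen := M.mul_genSignal_nonpos hb hsig
  have hq' := abs_intCast_le_of_mem_Icc hq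
  have hcost : |s * (M.γ * M.σ ^ 2 * (q : ℝ) ^ 2)| ≤ M.γ * M.σ ^ 2 * (M.qmMax : ℝ) ^ 2 := by
    rw [abs_mul, hs, one_mul, abs_mul, abs_of_nonneg (by positivity : 0 ≤ M.γ * M.σ ^ 2), abs_pow]
    gcongr
  have hsignal : |s * ((b : ℝ) * q)| ≤ M.bMax * M.qmMax := by
    rw [abs_mul, hs, one_mul, abs_mul]
    exact mul_le_mul (abs_intCast_le_of_mem_Icc hb) hq' (abs_nonneg _) hbm.le
  simp only [takerDrift, mul_sub]
  linarith [neg_le_of_abs_le hcost, le_of_abs_le hsignal]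

lemma exists_neg_le_mul_makerField (hf : IsFeedback (M.k / M.σ) f) :
    ∃ K, 0 ≤ K ∧ ∀ (s : ℝ) (W : ℤ → ℝ) (δb δa π : ℤ → ℤ → ℝ), ∀ q ∈ M.gridQ, |s| = 1 →
      (∀ q' ∈ M.gridQ, 0 ≤ s * (W q - W q')) →
      -(M.φ * M.σ ^ 2 * (M.qMax : ℝ) ^ 2 + M.qMax * |M.impact δb δa π| +
        (M.Lam (M.integ δa π) 0 + M.Lam (M.integ δb π) 0) * K) ≤
        s * M.makerField f δb δa π W q := by
  obtain ⟨K, hK₀, hK⟩ := M.exists_mul_hamMaker_le hf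
  have hφ := M.φ_pos
  refine ⟨K, hK₀, fun s W δb δa π q hq hs h ↦ ?_⟩
  have hham := hK s W δb δa π q hq hs h
  have hq' := abs_intCast_le_of_mem_Icc hq
  have hcost : |s * (M.φ * M.σ ^ 2 * (q : ℝ) ^ 2)| ≤ M.φ * M.σ ^ 2 * (M.qMax : ℝ) ^ 2 := by
    rw [abs_mul, hs, one_mul, abs_mul, abs_of_nonneg (by positivity : 0 ≤ M.φ * M.σ ^ 2), abs_pow]
    gcongr
  have himpact : |s * (q * M.impact δb δa π)| ≤ M.qMax * |M.impact δb δa π| := by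
    rw [abs_mul, hs, one_mul, abs_mul]
    exact mul_le_mul_of_nonneg_right hq' (abs_nonneg _)
  simp only [makerField, mul_sub]
  linarith [neg_le_of_abs_le hcost, le_of_abs_le himpact]

end Bounds

section Continuity

variable {X : Type*} [TopologicalSpace X] {s : Set X} {f fm : ℝ → ℝ}
  {v δb δa π : X → ℤ → ℤ → ℝ} {W : X → ℤ → ℝ}

lemma continuousOn_takerBid (hfm : Continuous fm) (hv : ContinuousOn v s) :
    ContinuousOn (fun x ↦ takerBid fm (v x)) s := by
  unfold takerBid
  fun_prop

lemma continuousOn_takerAsk (hfm : Continuous fm) (hv : ContinuousOn v s) :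
    ContinuousOn (fun x ↦ takerAsk fm (v x)) s := by
  unfold takerAsk
  fun_prop

lemma continuousOn_Lam_integ (hδa : ContinuousOn δa s) (hπ : ContinuousOn π s) (y : ℝ) :
    ContinuousOn (fun x ↦ M.Lam (M.integ (δa x) (π x)) y) s := by
  unfold Lam integ
  fun_prop

lemma continuousOn_impact (hδb : ContinuousOn δb s) (hδa : ContinuousOn δa s)
    (hπ : ContinuousOn π s) : ContinuousOn (fun x ↦ M.impact (δb x) (δa x) (π x)) s := by
  unfold impact integ netRate Lamm
  fun_prop

lemma continuousOn_fokkerPlanck (hδb : ContinuousOn δb s) (hδa : ContinuousOn δa s)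
    (hπ : ContinuousOn π s) (q b : ℤ) :
    ContinuousOn (fun x ↦ M.fokkerPlanck (δb x) (δa x) (π x) q b) s := by
  unfold fokkerPlanck Lamm
  fun_prop

lemma continuousOn_takerField (hfm : Continuous fm) (hv : ContinuousOn v s)
    (hπ : ContinuousOn π s) (q b : ℤ) :
    ContinuousOn (fun x ↦ M.takerField fm (v x) (π x) q b) s := by
  unfold takerField takerDrift genSignal hamTaker impact integ netRate takerBid takerAsk Lamm gain
  fun_prop

lemma continuousOn_makerField (hf : Continuous f) (hδb : ContinuousOn δb s)
    (hδa : ContinuousOn δa s) (hπ : ContinuousOn π s) (hW : ContinuousOn W s) (q : ℤ) :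
    ContinuousOn (fun x ↦ M.makerField f (δb x) (δa x) (π x) (W x) q) s := by
  unfold makerField hamMaker impact integ netRate Lam Lamm gain
  fun_prop

end Continuity

section FokkerPlanck

variable (δb δa π : ℤ → ℤ → ℝ)

/-- The generator of the inventory of the market-takers, applied to the function `ψ` of the
inventory. -/
def inventoryGen (δb δa : ℤ → ℤ → ℝ) (ψ : ℤ → ℝ) (y z : ℤ) : ℝ :=
  (if y < M.qmMax then 1 else 0) * M.Lamm (δb y z) * (ψ (y + 1) - ψ y)
    + (if -M.qmMax < y then 1 else 0) * M.Lamm (δa y z) * (ψ (y - 1) - ψ y)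

theorem integ_fokkerPlanck (ψ : ℤ → ℝ) :
    M.integ (fun q _ ↦ ψ q) (M.fokkerPlanck δb δa π) =
      -M.integ (M.inventoryGen δb δa ψ) π := by
  have hbid : ∑ q ∈ M.gridQm, ∑ b ∈ M.gridB,
        (if -M.qmMax < q then 1 else 0) * (ψ (q - 1 + 1) * M.Lamm (δb (q - 1) b) * π (q - 1) b) =
      ∑ q ∈ M.gridQm, ∑ b ∈ M.gridB,
        (if q < M.qmMax then 1 else 0) * (ψ (q + 1) * M.Lamm (δb q b) * π q b) := by
    rw [Finset.sum_comm, Finset.sum_comm (s := M.gridQm)]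
    exact Finset.sum_congr rfl fun b _ ↦
      sum_Icc_sub_one M.qmMax fun q ↦ ψ (q + 1) * M.Lamm (δb q b) * π q b
  have hask : ∑ q ∈ M.gridQm, ∑ b ∈ M.gridB,
        (if q < M.qmMax then 1 else 0) * (ψ (q + 1 - 1) * M.Lamm (δa (q + 1) b) * π (q + 1) b) =
      ∑ q ∈ M.gridQm, ∑ b ∈ M.gridB,
        (if -M.qmMax < q then 1 else 0) * (ψ (q - 1) * M.Lamm (δa q b) * π q b) := by
    rw [Finset.sum_comm, Finset.sum_comm (s := M.gridQm)]
    exact Finset.sum_congr rfl fun b _ ↦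
      sum_Icc_add_one M.qmMax fun q ↦ ψ (q - 1) * M.Lamm (δa q b) * π q b
  have hup (q : ℤ) := sum_Icc_sub_one M.bMax fun b ↦ M.lamPlus * ψ q * π q b
  have hdown (q : ℤ) := sum_Icc_add_one M.bMax fun b ↦ M.lamMinus * ψ q * π q b
  have hsignal := congrArg₂ (· + ·) (Finset.sum_congr rfl fun q (_ : q ∈ M.gridQm) ↦ hup q)
    (Finset.sum_congr rfl fun q (_ : q ∈ M.gridQm) ↦ hdown q)
  have hall := sub_eq_zero.2 (congrArg₂ (· + ·) (congrArg₂ (· + ·) hbid hask) hsignal)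
  refine eq_neg_of_add_eq_zero_left (neg_eq_zero.1 (Eq.trans ?_ hall))
  simp only [integ, fokkerPlanck, inventoryGen, gridB, ← Finset.sum_add_distrib,
    ← Finset.sum_sub_distrib, ← Finset.sum_neg_distrib]
  refine Finset.sum_congr rfl fun q _ ↦ Finset.sum_congr rfl fun b _ ↦ ?_
  rw [sub_add_cancel, add_sub_cancel_right]
  ring

lemma inventoryGen_const (c : ℝ) : M.inventoryGen δb δa (fun _ ↦ c) = 0 := by
  ext y z
  simp [inventoryGen]

lemma inventoryGen_intCast :
    M.inventoryGen δb δa (fun y ↦ (y : ℝ)) = fun y z ↦ M.netRate y (δb y z) (δa y z) := by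
  ext y z
  simp [inventoryGen, netRate, sub_eq_add_neg]

variable {δb δa π} in
lemma fokkerPlanck_nonpos (hπ : ∀ q b, 0 ≤ π q b) {q b : ℤ} (hzero : π q b = 0) :
    M.fokkerPlanck δb δa π q b ≤ 0 := by
  have hind (P : Prop) [Decidable P] : (0 : ℝ) ≤ if P then 1 else 0 := by
    split_ifs <;> norm_num
  have hinflow := add_nonneg
    (add_nonneg
      (mul_nonneg (mul_nonneg (hind (-M.qmMax < q)) (M.Lamm_pos (δb (q - 1) b)).le) (hπ (q - 1) b))
      (mul_nonneg (mul_nonneg (hind (q < M.qmMax)) (M.Lamm_pos (δa (q + 1) b)).le) (hπ (q + 1) b)))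
    (add_nonneg
      (mul_nonneg (mul_nonneg M.lamPlus_pos.le (hind (-M.bMax < b))) (hπ q (b - 1)))
      (mul_nonneg (mul_nonneg M.lamMinus_pos.le (hind (b < M.bMax))) (hπ q (b + 1))))
  rw [fokkerPlanck, hzero, mul_zero]
  linarith

end FokkerPlanck

variable {M} {π : ℤ → ℤ → ℝ}

lemma IsPMF.le_one (hπ : M.IsPMF π) {q b : ℤ} (hq : q ∈ M.gridQm) (hb : b ∈ M.gridB) :
    π q b ≤ 1 := calc
  π q b ≤ ∑ b ∈ M.gridB, π q b := Finset.single_le_sum (f := fun b ↦ π q b) (hπ.1 q hq) hb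
  _ ≤ ∑ q ∈ M.gridQm, ∑ b ∈ M.gridB, π q b :=
    Finset.single_le_sum (f := fun q ↦ ∑ b ∈ M.gridB, π q b)
      (fun q hq ↦ Finset.sum_nonneg (hπ.1 q hq)) hq
  _ = 1 := hπ.2

variable (M) in
/-- The mean inventory of the market-takers, when `π` is their law. -/
def meanInventory (π : ℤ → ℤ → ℝ) : ℝ := M.integ (fun y _ ↦ y) π

lemma IsPMF.abs_meanInventory_le (hπ : M.IsPMF π) : |M.meanInventory π| ≤ M.qmMax := calc
  |M.meanInventory π| ≤ ∑ q ∈ M.gridQm, ∑ b ∈ M.gridB, (M.qmMax : ℝ) * π q b := by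
    unfold meanInventory integ
    refine (Finset.abs_sum_le_sum_abs _ _).trans (Finset.sum_le_sum fun q hq ↦
      (Finset.abs_sum_le_sum_abs _ _).trans (Finset.sum_le_sum fun b hb ↦ ?_))
    rw [abs_mul, abs_of_nonneg (hπ.1 q hq b hb)]
    exact mul_le_mul_of_nonneg_right (abs_intCast_le_of_mem_Icc hq) (hπ.1 q hq b hb)
  _ = M.qmMax := by simp_rw [← Finset.mul_sum]; rw [hπ.2, mul_one]

end MarketModel

/-! ### The equations of the market-takers -/

namespace MarketModel

section TakerFlow

/-- `w` and `p` solve the equations of the market-takers on the grid, with the right-hand sides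
evaluated at the value function `v` and the law `ρ`. The equations themselves are the case `v = w`
and `ρ = p`; the other cases come from truncating them. -/
structure IsTakerFlow (M : MarketModel) (fm : ℝ → ℝ) (P₀ : ℤ → ℤ → ℝ)
    (v ρ w p : ℝ → ℤ → ℤ → ℝ) : Prop where
  hasDeriv_value : ∀ q ∈ M.gridQm, ∀ b ∈ M.gridB, ∀ t ∈ Icc 0 M.T,
    HasDerivWithinAt (fun s ↦ w s q b) (M.takerField fm (v t) (ρ t) q b) (Icc 0 M.T) t
  hasDeriv_mass : ∀ q ∈ M.gridQm, ∀ b ∈ M.gridB, ∀ t ∈ Icc 0 M.T,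
    HasDerivWithinAt (fun s ↦ p s q b)
      (-M.fokkerPlanck (takerBid fm (v t)) (takerAsk fm (v t)) (ρ t) q b) (Icc 0 M.T) t
  terminal_value : ∀ q ∈ M.gridQm, ∀ b ∈ M.gridB, w M.T q b = 0
  initial_mass : ∀ q ∈ M.gridQm, ∀ b ∈ M.gridB, p 0 q b = P₀ q b

/-- The permanent impact that the market-takers, with laws `p`, still exert between the times `t`
and `T`: the integral of the impact drift, which is `κ` times the derivative of their mean
inventory. -/
def futureImpact (M : MarketModel) (p : ℝ → ℤ → ℤ → ℝ) (t : ℝ) : ℝ :=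
  M.κ * (M.meanInventory (p M.T) - M.meanInventory (p t))

variable {M : MarketModel} {fm : ℝ → ℝ} {P₀ : ℤ → ℤ → ℝ} {v ρ w p : ℝ → ℤ → ℤ → ℝ} {t : ℝ}

lemma abs_futureImpact_le (hp : ∀ t ∈ Icc 0 M.T, M.IsPMF (p t)) (ht : t ∈ Icc 0 M.T) :
    |M.futureImpact p t| ≤ 2 * M.κ * M.qmMax := calc
  |M.futureImpact p t| ≤ M.κ * (|M.meanInventory (p M.T)| + |M.meanInventory (p t)|) := by
    rw [futureImpact, abs_mul, abs_of_pos M.κ_pos]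
    exact mul_le_mul_of_nonneg_left (abs_sub _ _) M.κ_pos.le
  _ ≤ M.κ * (M.qmMax + M.qmMax) := by
    refine mul_le_mul_of_nonneg_left (add_le_add ?_ ?_) M.κ_pos.le
    · exact (hp _ (right_mem_Icc.2 M.T_pos.le)).abs_meanInventory_le
    · exact (hp t ht).abs_meanInventory_le
  _ = 2 * M.κ * M.qmMax := by ring

namespace IsTakerFlow

lemma hasDerivWithinAt_integ (h : M.IsTakerFlow fm P₀ v ρ w p) (ht : t ∈ Icc 0 M.T)
    (ψ : ℤ → ℝ) :
    HasDerivWithinAt (fun s ↦ M.integ (fun y _ ↦ ψ y) (p s))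
      (M.integ (M.inventoryGen (takerBid fm (v t)) (takerAsk fm (v t)) ψ) (ρ t))
      (Icc 0 M.T) t := by
  have hsum := HasDerivWithinAt.fun_sum fun q (hq : q ∈ M.gridQm) ↦
    HasDerivWithinAt.fun_sum fun b (hb : b ∈ M.gridB) ↦
      (h.hasDeriv_mass q hq b hb t ht).const_mul (ψ q)
  simp only [mul_neg, Finset.sum_neg_distrib] at hsum
  rwa [← neg_neg (M.integ (M.inventoryGen _ _ _) _), ← integ_fokkerPlanck]

lemma nonneg_mass (h : M.IsTakerFlow fm P₀ v ρ w p) (hP₀ : M.IsPMF P₀)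
    (hρ : ∀ t q b, 0 ≤ ρ t q b) (hzero : ∀ t q b, p t q b < 0 → ρ t q b = 0) {q b : ℤ}
    (hq : q ∈ M.gridQm) (hb : b ∈ M.gridB) : ∀ t ∈ Icc 0 M.T, 0 ≤ p t q b := by
  refine nonneg_of_deriv_nonneg_of_neg (h.hasDeriv_mass q hq b hb) ?_ fun t _ hneg ↦ ?_
  · rw [h.initial_mass q hq b hb]
    exact hP₀.1 q hq b hb
  · exact neg_nonneg.2 (M.fokkerPlanck_nonpos (hρ t) (hzero t q b hneg))

lemma isPMF (h : M.IsTakerFlow fm P₀ v ρ w p) (hP₀ : M.IsPMF P₀)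
    (hp : ∀ q ∈ M.gridQm, ∀ b ∈ M.gridB, ∀ t ∈ Icc 0 M.T, 0 ≤ p t q b) (ht : t ∈ Icc 0 M.T) :
    M.IsPMF (p t) := by
  have hderiv (s) (hs : s ∈ Icc 0 M.T) :
      HasDerivWithinAt (fun s ↦ ∑ q ∈ M.gridQm, ∑ b ∈ M.gridB, p s q b) 0 (Icc 0 M.T) s := by
    simpa [inventoryGen_const, integ] using h.hasDerivWithinAt_integ hs fun _ ↦ 1
  refine ⟨fun q hq b hb ↦ hp q hq b hb t ht, ?_⟩
  rw [eq_left_of_hasDerivWithinAt_zero hderiv t ht, ← hP₀.2]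
  exact Finset.sum_congr rfl fun q hq ↦ Finset.sum_congr rfl fun b hb ↦ h.initial_mass q hq b hb

lemma hasDerivWithinAt_futureImpact (h : M.IsTakerFlow fm P₀ v ρ w p) (ht : t ∈ Icc 0 M.T) :
    HasDerivWithinAt (M.futureImpact p)
      (-M.impact (takerBid fm (v t)) (takerAsk fm (v t)) (ρ t)) (Icc 0 M.T) t := by
  have hmean := h.hasDerivWithinAt_integ ht fun y ↦ (y : ℝ)
  rw [inventoryGen_intCast] at hmean
  have himpact := (hmean.const_sub (M.meanInventory (p M.T))).const_mul M.κ
  rwa [mul_neg] at himpact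

lemma hasDerivWithinAt_sub_futureImpact (h : M.IsTakerFlow fm P₀ v ρ w p) (ht : t ∈ Icc 0 M.T)
    {q b : ℤ} (hq : q ∈ M.gridQm) (hb : b ∈ M.gridB) :
    HasDerivWithinAt (fun s ↦ w s q b - q * M.futureImpact p s) (M.takerDrift fm (v t) q b)
      (Icc 0 M.T) t := by
  simpa [takerField] using (h.hasDeriv_value q hq b hb t ht).fun_sub
    ((h.hasDerivWithinAt_futureImpact ht).const_mul (q : ℝ))

lemma abs_sub_futureImpact_le {C L : ℝ} (h : M.IsTakerFlow fm P₀ v ρ w p)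
    (hp : ∀ t ∈ Icc 0 M.T, M.IsPMF (p t))
    (hv : ∀ t ∈ Icc 0 M.T, ∀ q ∈ M.gridQm, ∀ b ∈ M.gridB, v t q b = clamp L (w t q b))
    (hC : ∀ (s : ℝ) (u : ℤ → ℤ → ℝ), ∀ q ∈ M.gridQm, ∀ b ∈ M.gridB, |s| = 1 →
      (∀ q' ∈ M.gridQm, -(2 * M.κ * M.qmMax * |(q' : ℝ) - q|) ≤ s * (u q b - u q' b)) →
      (∀ b' ∈ M.gridB, 0 ≤ s * (u q b - u q b')) → -C ≤ s * M.takerDrift fm u q b) :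
    ∀ t ∈ Icc 0 M.T, ∀ i ∈ M.gridQm ×ˢ M.gridB,
      |w t i.1 i.2 - i.1 * M.futureImpact p t| ≤ C * (M.T - t) := by
  have hqm : (0 : ℝ) < M.qmMax := mod_cast M.qmMax_pos
  have hκ := M.κ_pos
  refine abs_le_of_signed_deriv_ge_at_argmax (M.gridQm ×ˢ M.gridB)
    (u' := fun t i ↦ M.takerDrift fm (v t) i.1 i.2) (fun t ht i hi ↦ ?_) (fun i hi ↦ ?_) ?_
  · obtain ⟨hq, hb⟩ := Finset.mem_product.1 hi
    exact h.hasDerivWithinAt_sub_futureImpact ht hq hb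
  · obtain ⟨hq, hb⟩ := Finset.mem_product.1 hi
    simp [h.terminal_value _ hq _ hb, futureImpact]
  rintro s hs t ht ⟨q, b⟩ hi hmax
  obtain ⟨hq, hb⟩ := Finset.mem_product.1 hi
  refine hC s (v t) q hq b hb hs (fun q' hq' ↦ ?_) fun b' hb' ↦ ?_
  · rw [hv t ht q hq b hb, hv t ht q' hq' b hb]
    refine neg_le_mul_clamp_sub_clamp hs (by positivity) ?_
    have hshift : |s * (((q' : ℝ) - q) * M.futureImpact p t)| ≤
        2 * M.κ * M.qmMax * |(q' : ℝ) - q| := by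
      rw [abs_mul, hs, one_mul, abs_mul, mul_comm]
      exact mul_le_mul_of_nonneg_right (abs_futureImpact_le hp ht) (abs_nonneg _)
    have hle : s * (w t q' b - q' * M.futureImpact p t) ≤ s * (w t q b - q * M.futureImpact p t) :=
      hmax (q', b) (Finset.mk_mem_product hq' hb)
    linarith [le_of_abs_le hshift]
  · rw [hv t ht q hq b hb, hv t ht q hq b' hb', ← neg_zero]
    have hle : s * (w t q b' - q * M.futureImpact p t) ≤ s * (w t q b - q * M.futureImpact p t) :=
      hmax (q, b') (Finset.mk_mem_product hq hb')
    exact neg_le_mul_clamp_sub_clamp hs le_rfl (by linarith)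

end IsTakerFlow

variable (M) in
theorem exists_uniform_bound_takerFlow (hfm : IsFeedback (M.km / M.σ) fm) :
    ∃ R, 0 ≤ R ∧ ∀ (L : ℝ) (P₀ : ℤ → ℤ → ℝ) (v ρ w p : ℝ → ℤ → ℤ → ℝ),
      M.IsTakerFlow fm P₀ v ρ w p → (∀ t ∈ Icc 0 M.T, M.IsPMF (p t)) →
      (∀ t ∈ Icc 0 M.T, ∀ q ∈ M.gridQm, ∀ b ∈ M.gridB, v t q b = clamp L (w t q b)) →
      ∀ t ∈ Icc 0 M.T, ∀ q ∈ M.gridQm, ∀ b ∈ M.gridB, |w t q b| ≤ R := by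
  obtain ⟨C, hC₀, hC⟩ := M.exists_neg_le_mul_takerDrift hfm (2 * M.κ * M.qmMax)
  have hqm : (0 : ℝ) < M.qmMax := mod_cast M.qmMax_pos
  have hκ := M.κ_pos
  have hT := M.T_pos
  refine ⟨C * M.T + M.qmMax * (2 * M.κ * M.qmMax), by positivity, ?_⟩
  intro L P₀ v ρ w p hflow hp hv t ht q hq b hb
  have hshifted :=
    hflow.abs_sub_futureImpact_le hp hv hC t ht (q, b) (Finset.mk_mem_product hq hb)
  have himpact : |(q : ℝ) * M.futureImpact p t| ≤ M.qmMax * (2 * M.κ * M.qmMax) := by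
    rw [abs_mul]
    exact mul_le_mul (abs_intCast_le_of_mem_Icc hq) (abs_futureImpact_le hp ht) (abs_nonneg _)
      hqm.le
  calc |w t q b| ≤ |w t q b - q * M.futureImpact p t| + |(q : ℝ) * M.futureImpact p t| := by
        simpa using abs_add_le (w t q b - q * M.futureImpact p t) (q * M.futureImpact p t)
    _ ≤ C * (M.T - t) + M.qmMax * (2 * M.κ * M.qmMax) := add_le_add hshifted himpact
    _ ≤ C * M.T + M.qmMax * (2 * M.κ * M.qmMax) := by
      gcongr
      linarith [ht.1]

end TakerFlow

section Ghost

lemma qmMax_mem_gridQm (M : MarketModel) : M.qmMax ∈ M.gridQm :=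
  Finset.right_mem_Icc.2 (neg_le_self M.qmMax_pos.le)

lemma neg_qmMax_mem_gridQm (M : MarketModel) : -M.qmMax ∈ M.gridQm :=
  Finset.left_mem_Icc.2 (neg_le_self M.qmMax_pos.le)

variable (M : MarketModel) (ePlus eMinus : ℝ → ℤ → ℝ → ℝ)

/-- The value function `w` with its values at the inventories `±(qmMax + 1)` replaced by the ones
which `ePlus` and `eMinus` prescribe. -/
def withGhost (t : ℝ) (w : ℤ → ℤ → ℝ) (q b : ℤ) : ℝ :=
  if b ∈ M.gridB ∧ q = M.qmMax + 1 then ePlus t b (w M.qmMax b)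
  else if b ∈ M.gridB ∧ q = -M.qmMax - 1 then eMinus t b (w (-M.qmMax) b) else w q b

variable {M ePlus eMinus}

lemma withGhost_of_mem {q : ℤ} (hq : q ∈ M.gridQm) (t : ℝ) (w : ℤ → ℤ → ℝ) (b : ℤ) :
    M.withGhost ePlus eMinus t w q b = w q b := by
  have hq' := Finset.mem_Icc.1 hq
  rw [withGhost, if_neg (by omega), if_neg (by omega)]

lemma withGhost_qmMax_add_one {b : ℤ} (hb : b ∈ M.gridB) (t : ℝ) (w : ℤ → ℤ → ℝ) :
    M.withGhost ePlus eMinus t w (M.qmMax + 1) b = ePlus t b (w M.qmMax b) :=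
  if_pos ⟨hb, rfl⟩

lemma withGhost_neg_qmMax_sub_one {b : ℤ} (hb : b ∈ M.gridB) (t : ℝ) (w : ℤ → ℤ → ℝ) :
    M.withGhost ePlus eMinus t w (-M.qmMax - 1) b = eMinus t b (w (-M.qmMax) b) := by
  have hqm := M.qmMax_pos
  rw [withGhost, if_neg (by omega), if_pos ⟨hb, rfl⟩]

lemma continuousOn_withGhost
    (hePlus : ∀ b ∈ M.gridB,
      ContinuousOn (fun z : ℝ × ℝ ↦ ePlus z.1 b z.2) (Icc 0 M.T ×ˢ univ))
    (heMinus : ∀ b ∈ M.gridB,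
      ContinuousOn (fun z : ℝ × ℝ ↦ eMinus z.1 b z.2) (Icc 0 M.T ×ˢ univ)) :
    ContinuousOn (fun z : ℝ × (ℤ → ℤ → ℝ) ↦ M.withGhost ePlus eMinus z.1 z.2)
      (Icc 0 M.T ×ˢ univ) := by
  have hcomp {e : ℝ → ℤ → ℝ → ℝ} {b : ℤ} (q : ℤ)
      (he : ContinuousOn (fun z : ℝ × ℝ ↦ e z.1 b z.2) (Icc 0 M.T ×ˢ univ)) :
      ContinuousOn (fun z : ℝ × (ℤ → ℤ → ℝ) ↦ e z.1 b (z.2 q b)) (Icc 0 M.T ×ˢ univ) :=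
    he.comp (f := fun z : ℝ × (ℤ → ℤ → ℝ) ↦ (z.1, z.2 q b)) (by fun_prop)
      fun z hz ↦ ⟨hz.1, mem_univ _⟩
  refine continuousOn_pi.2 fun q ↦ continuousOn_pi.2 fun b ↦ ?_
  unfold withGhost
  split_ifs with hplus hminus
  · exact hcomp M.qmMax (hePlus b hplus.1)
  · exact hcomp (-M.qmMax) (heMinus b hminus.1)
  · fun_prop

end Ghost

section TakerSystem

/-- The first half of the unknowns of `takerSystem`, as a value function. -/
def valuePart (x : (ℤ × ℤ) ⊕ (ℤ × ℤ) → ℝ) (q b : ℤ) : ℝ := x (.inl (q, b))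

/-- The second half of the unknowns of `takerSystem`, as a mass function. -/
def massPart (x : (ℤ × ℤ) ⊕ (ℤ × ℤ) → ℝ) (q b : ℤ) : ℝ := x (.inr (q, b))

/-- The points of the grid of the market-takers, once for the value function and once for the
mass function. -/
def takerGrid (M : MarketModel) : Finset ((ℤ × ℤ) ⊕ (ℤ × ℤ)) :=
  (M.gridQm ×ˢ M.gridB).disjSum (M.gridQm ×ˢ M.gridB)

/-- The right-hand sides of the equations of the market-takers, as a single vector field in the
values on the grid of the value function and of the mass function. -/
def takerSystem (M : MarketModel) (fm : ℝ → ℝ) (ePlus eMinus : ℝ → ℤ → ℝ → ℝ) (t : ℝ)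
    (x : (ℤ × ℤ) ⊕ (ℤ × ℤ) → ℝ) : (ℤ × ℤ) ⊕ (ℤ × ℤ) → ℝ :=
  let v := M.withGhost ePlus eMinus t (valuePart x)
  Sum.elim (fun i ↦ M.takerField fm v (massPart x) i.1 i.2)
    fun i ↦ -M.fokkerPlanck (takerBid fm v) (takerAsk fm v) (massPart x) i.1 i.2

variable {M : MarketModel} {fm : ℝ → ℝ} {P₀ : ℤ → ℤ → ℝ} {ePlus eMinus : ℝ → ℤ → ℝ → ℝ}

lemma continuous_valuePart : Continuous valuePart := by
  unfold valuePart
  fun_prop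

lemma continuous_massPart : Continuous massPart := by
  unfold massPart
  fun_prop

lemma continuousOn_takerSystem (hfm : Continuous fm)
    (hePlus : ∀ b ∈ M.gridB,
      ContinuousOn (fun z : ℝ × ℝ ↦ ePlus z.1 b z.2) (Icc 0 M.T ×ˢ univ))
    (heMinus : ∀ b ∈ M.gridB,
      ContinuousOn (fun z : ℝ × ℝ ↦ eMinus z.1 b z.2) (Icc 0 M.T ×ˢ univ)) :
    ContinuousOn (fun z : ℝ × ((ℤ × ℤ) ⊕ (ℤ × ℤ) → ℝ) ↦ M.takerSystem fm ePlus eMinus z.1 z.2)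
      (Icc 0 M.T ×ˢ univ) := by
  have hv : ContinuousOn (fun z : ℝ × ((ℤ × ℤ) ⊕ (ℤ × ℤ) → ℝ) ↦
      M.withGhost ePlus eMinus z.1 (valuePart z.2)) (Icc 0 M.T ×ˢ univ) :=
    (continuousOn_withGhost hePlus heMinus).comp
      (continuous_fst.prodMk (continuous_valuePart.comp continuous_snd)).continuousOn
      fun z hz ↦ ⟨hz.1, mem_univ _⟩
  have hmass : ContinuousOn (fun z : ℝ × ((ℤ × ℤ) ⊕ (ℤ × ℤ) → ℝ) ↦ massPart z.2)
      (Icc 0 M.T ×ˢ univ) := (continuous_massPart.comp continuous_snd).continuousOn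
  refine continuousOn_pi.2 ?_
  rintro (⟨q, b⟩ | ⟨q, b⟩)
  · exact M.continuousOn_takerField hfm hv hmass q b
  · exact (M.continuousOn_fokkerPlanck (continuousOn_takerBid hfm hv)
      (continuousOn_takerAsk hfm hv) hmass q b).neg

lemma isTakerFlow_of_isMultipointSolution {x : ℝ → (ℤ × ℤ) ⊕ (ℤ × ℤ) → ℝ}
    {Θ : ((ℤ × ℤ) ⊕ (ℤ × ℤ) → ℝ) → (ℤ × ℤ) ⊕ (ℤ × ℤ) → ℝ}
    (h : IsMultipointSolution M.takerGrid 0 M.T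
      (fun t y ↦ M.takerSystem fm ePlus eMinus t (Θ y))
      (Sum.elim (fun _ ↦ M.T) fun _ ↦ 0) (Sum.elim 0 fun i ↦ P₀ i.1 i.2) x) :
    M.IsTakerFlow fm P₀ (fun t ↦ M.withGhost ePlus eMinus t (valuePart (Θ (x t))))
      (fun t ↦ massPart (Θ (x t))) (fun t ↦ M.withGhost ePlus eMinus t (valuePart (x t)))
      fun t ↦ massPart (x t) := by
  have hinl {q b : ℤ} (hq : q ∈ M.gridQm) (hb : b ∈ M.gridB) : .inl (q, b) ∈ M.takerGrid :=
    Finset.inl_mem_disjSum.2 (Finset.mk_mem_product hq hb)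
  have hinr {q b : ℤ} (hq : q ∈ M.gridQm) (hb : b ∈ M.gridB) : .inr (q, b) ∈ M.takerGrid :=
    Finset.inr_mem_disjSum.2 (Finset.mk_mem_product hq hb)
  refine ⟨fun q hq b hb t ht ↦ ?_, fun q hq b hb ↦ h.hasDeriv _ (hinr hq hb),
    fun q hq b hb ↦ ?_, fun q hq b hb ↦ h.eq_at _ (hinr hq hb)⟩
  · simp only [withGhost_of_mem hq]
    exact h.hasDeriv _ (hinl hq hb) t ht
  · rw [withGhost_of_mem hq]
    exact h.eq_at _ (hinl hq hb)

theorem exists_apriori_bound_takerSystem (hfm : IsFeedback (M.km / M.σ) fm) (hP₀ : M.IsPMF P₀) :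
    ∃ R, 0 ≤ R ∧ ∀ x, IsMultipointSolution M.takerGrid 0 M.T
      (fun t y ↦ M.takerSystem fm ePlus eMinus t
        (Sum.elim (fun _ ↦ -R) 0 ⊔ Sum.elim (fun _ ↦ R) 1 ⊓ y))
      (Sum.elim (fun _ ↦ M.T) fun _ ↦ 0) (Sum.elim 0 fun i ↦ P₀ i.1 i.2) x →
      ∀ i ∈ M.takerGrid, ∀ t ∈ Icc 0 M.T,
        x t i ∈ Icc (Sum.elim (fun _ ↦ -R) 0 i) (Sum.elim (fun _ ↦ R) 1 i) := by
  obtain ⟨R, hR₀, hR⟩ := M.exists_uniform_bound_takerFlow hfm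
  refine ⟨R, hR₀, fun x hx ↦ ?_⟩
  have hflow := isTakerFlow_of_isMultipointSolution hx
  have hpmf (t) (ht : t ∈ Icc 0 M.T) : M.IsPMF (massPart (x t)) :=
    hflow.isPMF hP₀ (fun q hq b hb ↦ hflow.nonneg_mass hP₀ (fun t q b ↦ le_max_left _ _)
      (fun t q b hneg ↦ max_eq_left ((min_le_right _ _).trans hneg.le)) hq hb) ht
  rintro (⟨q, b⟩ | ⟨q, b⟩) hi t ht
  · obtain ⟨hq, hb⟩ := Finset.mem_product.1 (Finset.inl_mem_disjSum.1 hi)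
    have hle := hR R _ _ _ _ _ hflow hpmf
      (fun t _ q hq b _ ↦ by simp only [withGhost_of_mem hq]; rfl) t ht q hq b hb
    rw [withGhost_of_mem hq] at hle
    exact abs_le.1 hle
  · obtain ⟨hq, hb⟩ := Finset.mem_product.1 (Finset.inr_mem_disjSum.1 hi)
    exact ⟨(hpmf t ht).1 q hq b hb, (hpmf t ht).le_one hq hb⟩

theorem exists_isTakerFlow (hfm : IsFeedback (M.km / M.σ) fm) (hP₀ : M.IsPMF P₀)
    (hePlus : ∀ b ∈ M.gridB,
      ContinuousOn (fun z : ℝ × ℝ ↦ ePlus z.1 b z.2) (Icc 0 M.T ×ˢ univ))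
    (heMinus : ∀ b ∈ M.gridB,
      ContinuousOn (fun z : ℝ × ℝ ↦ eMinus z.1 b z.2) (Icc 0 M.T ×ˢ univ)) :
    ∃ w p : ℝ → ℤ → ℤ → ℝ, Continuous w ∧ Continuous p ∧ (∀ t ∈ Icc 0 M.T, M.IsPMF (p t)) ∧
      M.IsTakerFlow fm P₀ (fun t ↦ M.withGhost ePlus eMinus t (w t)) p
        (fun t ↦ M.withGhost ePlus eMinus t (w t)) p := by
  obtain ⟨R, hR₀, hR⟩ :=
    exists_apriori_bound_takerSystem (ePlus := ePlus) (eMinus := eMinus) hfm hP₀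
  have hbox : (Sum.elim (fun _ ↦ -R) 0 : (ℤ × ℤ) ⊕ (ℤ × ℤ) → ℝ) ≤ Sum.elim (fun _ ↦ R) 1 :=
    Sum.elim_le_elim_iff.2 ⟨fun _ ↦ neg_le_self hR₀, fun _ ↦ zero_le_one⟩
  have htime (i) (_ : i ∈ M.takerGrid) : Sum.elim (fun _ ↦ M.T) (fun _ ↦ 0) i ∈ Icc 0 M.T := by
    rcases i with i | i
    · exact right_mem_Icc.2 M.T_pos.le
    · exact left_mem_Icc.2 M.T_pos.le
  have hcont (i) (_ : i ∈ M.takerGrid) :=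
    ((continuous_apply i).comp_continuousOn
      (continuousOn_takerSystem hfm.continuous hePlus heMinus)).mono
        (prod_mono_right (subset_univ (Icc (Sum.elim (fun _ ↦ -R) 0) (Sum.elim (fun _ ↦ R) 1))))
  obtain ⟨x, hx, hmem, hsol⟩ := exists_isMultipointSolution_of_apriori_bound M.takerGrid
    M.T_pos.le hbox hcont htime _ hR
  have hflow := isTakerFlow_of_isMultipointSolution (Θ := id) hsol
  refine ⟨fun t ↦ valuePart (x t), fun t ↦ massPart (x t), continuous_valuePart.comp hx,
    continuous_massPart.comp hx, fun t ht ↦ hflow.isPMF hP₀ (fun q hq b hb s hs ↦ ?_) ht, hflow⟩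
  exact (hmem (.inr (q, b)) (Finset.inr_mem_disjSum.2 (Finset.mk_mem_product hq hb)) s hs).1

end TakerSystem

end MarketModel

/-! ### The equation of the market-maker -/

namespace MarketModel

section Maker

variable {M : MarketModel} {f : ℝ → ℝ} {δb δa π : ℝ → ℤ → ℤ → ℝ}

lemma exists_uniform_neg_le_mul_makerField (hf : IsFeedback (M.k / M.σ) f)
    (hδb : ContinuousOn δb (Icc 0 M.T)) (hδa : ContinuousOn δa (Icc 0 M.T))
    (hπ : ContinuousOn π (Icc 0 M.T)) :
    ∃ C, 0 ≤ C ∧ ∀ (s : ℝ) (W : ℤ → ℝ), ∀ t ∈ Icc 0 M.T, ∀ q ∈ M.gridQ, |s| = 1 →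
      (∀ q' ∈ M.gridQ, 0 ≤ s * (W q - W q')) →
      -C ≤ s * M.makerField f (δb t) (δa t) (π t) W q := by
  obtain ⟨K, -, hK⟩ := M.exists_neg_le_mul_makerField hf
  have himpact := M.continuousOn_impact hδb hδa hπ
  have hmarket := (M.continuousOn_Lam_integ hδa hπ 0).add (M.continuousOn_Lam_integ hδb hπ 0)
  obtain ⟨C, hC⟩ := isCompact_Icc.exists_bound_of_continuousOn
    (((himpact.abs.const_mul (M.qMax : ℝ)).const_add (M.φ * M.σ ^ 2 * (M.qMax : ℝ) ^ 2)).add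
      (hmarket.mul_const K))
  refine ⟨C, (norm_nonneg _).trans (hC 0 (left_mem_Icc.2 M.T_pos.le)),
    fun s W t ht q hq hs hmax ↦ ?_⟩
  exact (neg_le_neg ((le_abs_self _).trans (hC t ht))).trans (hK s W _ _ _ q hq hs hmax)

lemma abs_le_of_isMultipointSolution_makerField {C L : ℝ} {W : ℝ → ℤ → ℝ}
    (hC : ∀ (s : ℝ) (V : ℤ → ℝ), ∀ t ∈ Icc 0 M.T, ∀ q ∈ M.gridQ, |s| = 1 →
      (∀ q' ∈ M.gridQ, 0 ≤ s * (V q - V q')) →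
      -C ≤ s * M.makerField f (δb t) (δa t) (π t) V q)
    (hW : IsMultipointSolution M.gridQ 0 M.T
      (fun t V ↦ M.makerField f (δb t) (δa t) (π t) fun q ↦ clamp L (V q)) (fun _ ↦ M.T) 0 W) :
    ∀ t ∈ Icc 0 M.T, ∀ q ∈ M.gridQ, |W t q| ≤ C * (M.T - t) := by
  refine abs_le_of_signed_deriv_ge_at_argmax M.gridQ (fun t ht q hq ↦ hW.hasDeriv q hq t ht)
    hW.eq_at fun s hs t ht q hq hmax ↦ hC s _ t ht q hq hs fun q' hq' ↦ ?_
  rw [← neg_zero]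
  exact neg_le_mul_clamp_sub_clamp hs le_rfl (by linarith [hmax q' hq'])

theorem exists_isMultipointSolution_makerField (hf : IsFeedback (M.k / M.σ) f)
    (hδb : ContinuousOn δb (Icc 0 M.T)) (hδa : ContinuousOn δa (Icc 0 M.T))
    (hπ : ContinuousOn π (Icc 0 M.T)) :
    ∃ W, Continuous W ∧ IsMultipointSolution M.gridQ 0 M.T
      (fun t ↦ M.makerField f (δb t) (δa t) (π t)) (fun _ ↦ M.T) 0 W := by
  obtain ⟨C, hC₀, hC⟩ := exists_uniform_neg_le_mul_makerField hf hδb hδa hπ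
  have hCT : 0 ≤ C * M.T := mul_nonneg hC₀ M.T_pos.le
  have hcont (q) (_ : q ∈ M.gridQ) : ContinuousOn
      (fun z : ℝ × (ℤ → ℝ) ↦ M.makerField f (δb z.1) (δa z.1) (π z.1) z.2 q)
      (Icc 0 M.T ×ˢ Icc (fun _ ↦ -(C * M.T)) fun _ ↦ C * M.T) := by
    have hfst {δ : ℝ → ℤ → ℤ → ℝ} (hδ : ContinuousOn δ (Icc 0 M.T)) :=
      hδ.comp (continuousOn_fst (s := Icc 0 M.T ×ˢ Icc (fun _ : ℤ ↦ -(C * M.T)) fun _ ↦ C * M.T))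
        fun _ hz ↦ hz.1
    exact M.continuousOn_makerField hf.continuous (hfst hδb) (hfst hδa) (hfst hπ)
      continuousOn_snd q
  obtain ⟨W, hW, -, hsol⟩ := exists_isMultipointSolution_of_apriori_bound M.gridQ M.T_pos.le
    (F := fun t ↦ M.makerField f (δb t) (δa t) (π t)) (fun _ ↦ neg_le_self hCT) hcont
    (fun _ _ ↦ right_mem_Icc.2 M.T_pos.le) 0 fun W hW q hq t ht ↦ abs_le.1 <|
      (abs_le_of_isMultipointSolution_makerField hC hW t ht q hq).trans <|
        mul_le_mul_of_nonneg_left (by linarith [ht.1]) hC₀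
  exact ⟨W, hW, hsol⟩

theorem isMasterSolution_of_isTakerFlow {f fm : ℝ → ℝ} {ePlus eMinus : ℝ → ℤ → ℝ → ℝ}
    {P₀ : ℤ → ℤ → ℝ} {W : ℝ → ℤ → ℝ} {Wm p : ℝ → ℤ → ℤ → ℝ} (hf : Continuous f)
    (hfm : Continuous fm) (hW : ContinuousOn W (Icc 0 M.T)) (hWm : ContinuousOn Wm (Icc 0 M.T))
    (hp : ContinuousOn p (Icc 0 M.T)) (hpmf : ∀ t ∈ Icc 0 M.T, M.IsPMF (p t))
    (hplus : ∀ t ∈ Icc 0 M.T, ∀ b ∈ M.gridB,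
      Wm t (M.qmMax + 1) b = ePlus t b (Wm t M.qmMax b))
    (hminus : ∀ t ∈ Icc 0 M.T, ∀ b ∈ M.gridB,
      Wm t (-M.qmMax - 1) b = eMinus t b (Wm t (-M.qmMax) b))
    (htaker : M.IsTakerFlow fm P₀ Wm p Wm p)
    (hmaker : IsMultipointSolution M.gridQ 0 M.T
      (fun t ↦ M.makerField f (takerBid fm (Wm t)) (takerAsk fm (Wm t)) (p t))
      (fun _ ↦ M.T) 0 W) :
    M.IsMasterSolution f fm ePlus eMinus P₀ W Wm p := by
  have hunique := uniqueDiffOn_Icc M.T_pos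
  have hbid := continuousOn_takerBid hfm hWm
  have hask := continuousOn_takerAsk hfm hWm
  refine
    { contDiff_W := fun q hq ↦ contDiffOn_one_of_hasDerivWithinAt hunique
        (hmaker.hasDeriv q hq) (M.continuousOn_makerField hf hbid hask hp hW q)
      contDiff_Wm := fun q hq b hb ↦ contDiffOn_one_of_hasDerivWithinAt hunique
        (htaker.hasDeriv_value q hq b hb) (M.continuousOn_takerField hfm hWm hp q b)
      contDiff_p := fun q hq b hb ↦ contDiffOn_one_of_hasDerivWithinAt hunique
        (htaker.hasDeriv_mass q hq b hb) (M.continuousOn_fokkerPlanck hbid hask hp q b).neg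
      bounded_W := ?_
      bounded_Wm := ?_
      bounded_p := ⟨1, fun t ht q hq b hb ↦
        (abs_of_nonneg ((hpmf t ht).1 q hq b hb)).trans_le ((hpmf t ht).le_one hq hb)⟩
      pmf := hpmf
      ghost_plus := hplus
      ghost_minus := hminus
      hjb_maker := fun t ht q hq ↦ ?_
      hjb_taker := fun t ht q hq b hb ↦ ?_
      fokker_planck := fun t ht q hq b hb ↦ ?_
      initial_p := htaker.initial_mass
      terminal_W := hmaker.eq_at
      terminal_Wm := htaker.terminal_value }
  · obtain ⟨L, hL⟩ := exists_forall_norm_le_of_isCompact isCompact_Icc M.gridQ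
      fun q _ ↦ (continuous_apply q).comp_continuousOn hW
    exact ⟨L, fun t ht q hq ↦ hL q hq t ht⟩
  · obtain ⟨L, hL⟩ := exists_forall_norm_le_of_isCompact isCompact_Icc (M.gridQm ×ˢ M.gridB)
      (u := fun t i ↦ Wm t i.1 i.2)
      fun i _ ↦ (continuous_apply_apply i.1 i.2).comp_continuousOn hWm
    exact ⟨L, fun t ht q hq b hb ↦ hL (q, b) (Finset.mk_mem_product hq hb) t ht⟩
  · rw [(hmaker.hasDeriv q hq t ht).derivWithin (hunique t ht), makerField]
    ring
  · rw [(htaker.hasDeriv_value q hq b hb t ht).derivWithin (hunique t ht), takerField, takerDrift]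
    ring
  · rw [(htaker.hasDeriv_mass q hq b hb t ht).derivWithin (hunique t ht), neg_add_cancel]

end Maker

end MarketModel

section MasterEquation

open MarketModel

variable {M : MarketModel} {f fm : ℝ → ℝ} {P₀ : ℤ → ℤ → ℝ} {ePlus eMinus : ℝ → ℤ → ℝ → ℝ}

theorem mainTheorem1_general (hf : IsFeedback (M.k / M.σ) f) (hfm : IsFeedback (M.km / M.σ) fm)
    (hP₀ : M.IsPMF P₀)
    (hePlus : ∀ b ∈ M.gridB,
      ContinuousOn (fun z : ℝ × ℝ ↦ ePlus z.1 b z.2) (Icc 0 M.T ×ˢ univ))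
    (heMinus : ∀ b ∈ M.gridB,
      ContinuousOn (fun z : ℝ × ℝ ↦ eMinus z.1 b z.2) (Icc 0 M.T ×ˢ univ)) :
    ∃ (W : ℝ → ℤ → ℝ) (Wm p : ℝ → ℤ → ℤ → ℝ),
      M.IsMasterSolution f fm ePlus eMinus P₀ W Wm p := by
  obtain ⟨w, p, hw, hp, hpmf, htaker⟩ := exists_isTakerFlow hfm hP₀ hePlus heMinus
  have hghost := continuousOn_withGhost hePlus heMinus
  have hWm : ContinuousOn (fun t ↦ M.withGhost ePlus eMinus t (w t)) (Icc 0 M.T) :=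
    hghost.comp (continuous_id.prodMk hw).continuousOn fun t ht ↦ ⟨ht, mem_univ _⟩
  obtain ⟨W, hW, hmaker⟩ := exists_isMultipointSolution_makerField hf
    (continuousOn_takerBid hfm.continuous hWm) (continuousOn_takerAsk hfm.continuous hWm)
    hp.continuousOn
  refine ⟨W, _, p, isMasterSolution_of_isTakerFlow hf.continuous hfm.continuous hW.continuousOn
    hWm hp.continuousOn hpmf (fun t _ b hb ↦ ?_) (fun t _ b hb ↦ ?_) htaker hmaker⟩
  · rw [withGhost_qmMax_add_one hb, withGhost_of_mem M.qmMax_mem_gridQm]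
  · rw [withGhost_neg_qmMax_sub_one hb, withGhost_of_mem M.neg_qmMax_mem_gridQm]

end MasterEquation

end

theorem mainTheorem1 (M : MarketModel) (P₀ : ℤ → ℤ → ℝ) (hP₀ : M.IsPMF P₀)
    (ePlus eMinus : ℝ → ℤ → ℝ → ℝ)
    (hePlus : ∀ b ∈ M.gridB,
      ContinuousOn (fun x : ℝ × ℝ => ePlus x.1 b x.2) (Set.Icc 0 M.T ×ˢ Set.univ))
    (heMinus : ∀ b ∈ M.gridB,
      ContinuousOn (fun x : ℝ × ℝ => eMinus x.1 b x.2) (Set.Icc 0 M.T ×ˢ Set.univ)) :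
    (∃ (W : ℝ → ℤ → ℝ) (Wm p : ℝ → ℤ → ℤ → ℝ),
      M.IsMasterSolution M.dbar M.dmbar ePlus eMinus P₀ W Wm p) ∧
    (∀ δinf : ℝ, 0 < δinf → ∃ (W : ℝ → ℤ → ℝ) (Wm p : ℝ → ℤ → ℤ → ℝ),
      M.IsMasterSolution (fun x => MarketModel.clamp δinf (M.dbar x))
        (fun x => MarketModel.clamp δinf (M.dmbar x)) ePlus eMinus P₀ W Wm p) := by
  have hσ := M.σ_pos.le
  have hk := M.k_pos.le
  have hkm := M.km_pos.le
  refine ⟨mainTheorem1_general (.const_add (by positivity) (by positivity))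
    (.const_add (by positivity) (by positivity)) hP₀ hePlus heMinus, fun δinf hδ ↦ ?_⟩
  have hcont (e : ℝ) : Continuous fun x ↦ MarketModel.clamp δinf (e + x) :=
    (MarketModel.continuous_clamp δinf).comp (continuous_const_add e)
  exact mainTheorem1_general
    (.of_abs_le _ (hcont _) fun _ ↦ MarketModel.abs_clamp_le hδ.le _)
    (.of_abs_le _ (hcont _) fun _ ↦ MarketModel.abs_clamp_le hδ.le _) hP₀ hePlus heMinus
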